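/- **Setting.** There are $n$ agents, $m\ge 2$ states of the world $\theta_1,\dots,\theta_m$ with true state $\theta_1$, and $T\ge 1$ rounds. Agent $i$ has a signal space with likelihoods (probability mass functions, or densities with respect to a common reference measure) $\ell_i(\cdot|\theta_k)$; the signals $s_{i,t}\sim\ell_i(\cdot|\theta_1)$ are independent over agents $i\in[n]$ and rounds $t\in[T]$. Assume $|\log\ell_i(\cdot|\theta_k)|\le B$ for all $i,k$, and that $\theta_1$ is globally identifiable: for every $k\ne1$ some agent $i$ does not have $\ell_i(\cdot|\theta_k)=\ell_i(\cdot|\theta_1)$ with probability one. Let $W$ be the stochastic communication matrix, $\pi$ its stationary distribution ($\pi^{\mathsf T}W=\pi^{\mathsf T}$, $\sum_i\pi(i)=1$, $\pi\ge0$), $\lambda_{\max}(W)$ the largest modulus of an eigenvalue of $W$ other than the simple eigenvalue $1$, and $\gamma(W)=1-\lambda_{\max}(W)$. Put $\mathcal I(\theta_1,\theta_k)=\sum_i\pi(i)D_{KL}(\ell_i(\cdot|\theta_1)\|\ell_i(\cdot|\theta_k))$, and let $\theta_2$ be the state that minimizes this over $k\neq1$. With $\psi_{i,t}(k)=\log\ell_i(s_{i,t}|\theta_k)$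 and $\phi_{i,0}=\phi_0=0$, let $$\phi_{i,t}=\sum_j[W]_{ij}\phi_{j,t-1}+\psi_{i,t},\qquad \phi_t=\phi_{t-1}+\sum_i\pi(i)\psi_{i,t},$$ let $\mu_{i,t}$ and $\mu_t$ be the minimizers over the probability simplex $\Delta_m$ of $-\mu^{\mathsf T}\phi_{i,t}+\frac1\eta D_{KL}(\mu\|\mu_0)$ and of $-\mu^{\mathsf T}\phi_{t}+\frac1\eta D_{KL}(\mu\|\mu_0)$, where $\mu_0$ is uniform, and let $\mathbf{Cost}_{i,T}=\sum_{t=1}^TD_{KL}(\mu_{i,t}\|\mu_t)$. **Networks.** Fix $\omega\in(0,1)$. In a graph with self-reliance $\omega$, $[W]_{ii}=\omega$ and every agent splits the weight $1-\omega$ equally among its neighbours. The graphs are the star and the cycle on $n$ vertices, and, for $n$ a perfect square, the grid with wraparounds, i.e. the Cartesian product of two cycles of length $\sqrt n$. **Claim.** For all $B>0$ and $\iota>0$ there is a constant $C$ such that for every $\delta\in(0,1)$ there is an $N$ such that for all $n\ge N$, all $\omega\in(0,1)$, all $m\ge2$, $T\ge1$, all likelihoods as above with $\mathcal I(\theta_1,\theta_2)\ge\iota$,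 and every agent $i$, the choice of learning rate $\eta=\frac{\gamma(W)}{16B\log n}$ gives, with probability at least $1-\delta$: (a) for the star network, $$\mathbf{Cost}_{i,T}\le C\,\frac{\log[nmT]}{\min\{1-\omega,\;1-|2\omega-1|\}};$$ (b) for the cycle network, $$\mathbf{Cost}_{i,T}\le C\,\frac{\log[nmT]}{\min\{1-|2\omega-1|,\;2(1-\omega)\sin^2\frac{\pi}{n}\}};$$ (c) for the grid network (with $n$ a perfect square), $$\mathbf{Cost}_{i,T}\le C\,\frac{\log[nmT]}{\min\{1-|2\omega-1|,\;2(1-\omega)\sin^2\frac{\pi}{\sqrt n}\}}.$$ (In the sines, $\pi$ is the circle constant.) -/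

import Mathlib

open MeasureTheory ProbabilityTheory

universe u v

noncomputable section

namespace DistributedDetection

/-! ### Communication matrices -/

open Classical in
/-- The communication matrix of a graph in which every agent has self-reliance `ω` and splits the
remaining weight `1 - ω` equally among its neighbours. -/
def commMatrix {V : Type} [Fintype V] (G : SimpleGraph V) (ω : ℝ) : Matrix V V ℝ :=
  Matrix.of fun i j =>
    if i = j then ω else if G.Adj i j then (1 - ω) / (G.degree i : ℝ) else 0

/-- The two-dimensional grid with wraparounds: the Cartesian product of two rings of size `k`. -/
abbrev torusGrid (k : ℕ) : SimpleGraph (Fin k × Fin k) :=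
  (SimpleGraph.cycleGraph k).boxProd (SimpleGraph.cycleGraph k)

/-- `λ_max(W)`: the largest modulus of an eigenvalue of `W` other than the Perron eigenvalue `1`.
(It is used for irreducible stochastic matrices, whose eigenvalue `1` is simple, so that it is
`max {|λ₂|, |λₙ|}`.) -/
def secondModulus {V : Type} [Fintype V] [DecidableEq V] (W : Matrix V V ℝ) : ℝ :=
  sSup {x : ℝ | ∃ z ∈ spectrum ℂ (W.map ((↑) : ℝ → ℂ)), z ≠ 1 ∧ x = ‖z‖}

/-- The spectral gap `γ(W) = 1 - λ_max(W)`. -/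
def spectralGap {V : Type} [Fintype V] [DecidableEq V] (W : Matrix V V ℝ) : ℝ :=
  1 - secondModulus W

/-- The eigenvector centrality: a probability vector with `π i = ∑ j, W j i * π j`. -/
structure IsCentrality {V : Type} [Fintype V] (W : Matrix V V ℝ) (π : V → ℝ) : Prop where
  nonneg : ∀ i, 0 ≤ π i
  sum_eq_one : ∑ i, π i = 1
  stationary : ∀ i, π i = ∑ j, W j i * π j

/-! ### Observation model -/

/-- Marginal likelihoods of the agents `V` under `m` states of the world: agent `i` has a signal
space `S i` and, for each state `k`, a probability density `lik i k` with respect to a reference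
measure `ref i` (for a discrete signal space, the counting measure). -/
structure SignalModel (V : Type) (m : ℕ) where
  S : V → Type u
  meas : ∀ i, MeasurableSpace (S i)
  ref : ∀ i, Measure (S i)
  lik : ∀ i, Fin m → S i → ℝ
  lik_nonneg : ∀ i k x, 0 ≤ lik i k x
  lik_measurable : ∀ i k, Measurable (lik i k)
  lik_normalized : ∀ i k, ∫⁻ x, ENNReal.ofReal (lik i k x) ∂(ref i) = 1

namespace SignalModel

instance {V : Type} {m : ℕ} (M : SignalModel.{u} V m) (i : V) : MeasurableSpace (M.S i) :=
  M.meas i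

variable {V : Type} {m : ℕ}

/-- The distribution of a signal of agent `i` when the state of the world is `k`. -/
def law (M : SignalModel.{u} V m) (i : V) (k : Fin m) : Measure (M.S i) :=
  (M.ref i).withDensity fun x => ENNReal.ofReal (M.lik i k x)

/-- All log-marginals are bounded by `B` in absolute value. -/
def LogBounded (M : SignalModel.{u} V m) (B : ℝ) : Prop :=
  ∀ i k x, 0 < M.lik i k x ∧ |Real.log (M.lik i k x)| ≤ B

/-- Global identifiability: no state other than the true state `θ` is observationally equivalent
to `θ` for all agents. -/
def Identifiable (M : SignalModel.{u} V m) (θ : Fin m) : Prop :=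
  ∀ k, (∀ i, ∀ᵐ x ∂(M.law i θ), M.lik i k x = M.lik i θ x) → k = θ

/-- `I(θ, k) = ∑ i, π i * D_KL(ℓ_i(·|θ) ‖ ℓ_i(·|k))`. -/
def info [Fintype V] (M : SignalModel.{u} V m) (π : V → ℝ) (θ k : Fin m) : ℝ :=
  ∑ i, π i * (InformationTheory.klDiv (M.law i θ) (M.law i k)).toReal

/-- The random signals `s t i` of the rounds `t = 1, …, T` are independent over rounds and agents,
and those of agent `i` are distributed according to `ℓ_i(·|θ)`. -/
structure IsSignalSequence (M : SignalModel.{u} V m) (θ : Fin m) (T : ℕ)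
    {Ω : Type v} [MeasurableSpace Ω] (P : Measure Ω) (s : ℕ → ∀ i, Ω → M.S i) : Prop where
  hasLaw : ∀ t ∈ Set.Icc 1 T, ∀ i, HasLaw (s t i) (M.law i θ) P
  indep : iIndepFun (fun p : Set.Icc 1 T × V => s p.1 p.2) P

/-- The log-marginals `ψ_{i,t}(k) = log ℓ_i(s_{i,t} | k)` of a realization of the signals. -/
def logLik (M : SignalModel.{u} V m) (s : ℕ → ∀ i, M.S i) (t : ℕ) (i : V) (k : Fin m) : ℝ :=
  Real.log (M.lik i k (s t i))

end SignalModel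

/-! ### The two algorithms and the decentralization cost -/

/-- Kullback-Leibler divergence of probability vectors. -/
def klVec {m : ℕ} (p q : Fin m → ℝ) : ℝ := ∑ k, p k * Real.log (p k / q k)

/-- The belief formed from the accumulated log-marginals `φ`: a minimizer over the probability
simplex of `-⟨μ, φ⟩ + D_KL(μ ‖ μ₀) / η`, where the prior `μ₀` is uniform. -/
structure IsBelief {m : ℕ} (η : ℝ) (φ μ : Fin m → ℝ) : Prop where
  mem_simplex : μ ∈ stdSimplex ℝ (Fin m)
  isMinOn : IsMinOn (fun p : Fin m → ℝ => -(∑ k, p k * φ k) + 1 / η * klVec p fun _ => 1 / (m : ℝ))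
    (stdSimplex ℝ (Fin m)) μ

/-- Accumulation in centralized detection: `φ_t = φ_{t-1} + ∑ i, π i ψ_{i,t}`, `φ_0 = 0`. -/
def centralPhi {V : Type} [Fintype V] {m : ℕ} (π : V → ℝ) (ψ : ℕ → V → Fin m → ℝ) :
    ℕ → Fin m → ℝ
  | 0 => fun _ => 0
  | t + 1 => fun k => centralPhi π ψ t k + ∑ i, π i * ψ (t + 1) i k

/-- Accumulation in distributed detection: `φ_{i,t} = ∑ j, W i j φ_{j,t-1} + ψ_{i,t}`,
`φ_{i,0} = 0`. -/
def agentPhi {V : Type} [Fintype V] {m : ℕ} (W : Matrix V V ℝ) (ψ : ℕ → V → Fin m → ℝ) :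
    ℕ → V → Fin m → ℝ
  | 0 => fun _ _ => 0
  | t + 1 => fun i k => ∑ j, W i j * agentPhi W ψ t j k + ψ (t + 1) i k

/-- The decentralization cost `∑_{t=1}^T D_KL(μ_{i,t} ‖ μ_t)`. -/
def decentralizationCost {m : ℕ} (T : ℕ) (μAgent μCentral : ℕ → Fin m → ℝ) : ℝ :=
  ∑ t ∈ Finset.Icc 1 T, klVec (μAgent t) (μCentral t)

/-- For every problem on the network with communication matrix `W` (numbers `m ≥ 2` of states and
`T ≥ 1` of rounds, a signal model, a true state) with log-marginals bounded by `B`, globally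
identifiable true state `θ`, and `I(θ, k) ≥ ι` for every other state `k` (that is, for the second
best one), both algorithms being run with the learning rate `η = γ(W) / (16 B log n)`: the
decentralization cost of each agent is at most `bound m T` with probability at least `1 - δ`. -/
def CostBound {V : Type} [Fintype V] [DecidableEq V] (W : Matrix V V ℝ) (B ι δ : ℝ)
    (bound : ℕ → ℕ → ℝ) : Prop :=
  ∀ m T : ℕ, 2 ≤ m → 1 ≤ T →
  ∀ (M : SignalModel.{u} V m) (θ : Fin m), M.LogBounded B → M.Identifiable θ →
  ∀ π : V → ℝ, IsCentrality W π → (∀ k, k ≠ θ → ι ≤ M.info π θ k) →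
  ∀ (Ω : Type v) [MeasurableSpace Ω] (P : Measure Ω) [IsProbabilityMeasure P]
    (s : ℕ → ∀ i, Ω → M.S i), M.IsSignalSequence θ T P s →
  ∀ η : ℝ, η = spectralGap W / (16 * B * Real.log (Fintype.card V)) →
  ∀ (i : V) (μAgent μCentral : Ω → ℕ → Fin m → ℝ),
    (∀ ω, ∀ t ∈ Finset.Icc 1 T,
      IsBelief η (agentPhi W (M.logLik fun t i => s t i ω) t i) (μAgent ω t)) →
    (∀ ω, ∀ t ∈ Finset.Icc 1 T,
      IsBelief η (centralPhi π (M.logLik fun t i => s t i ω) t) (μCentral ω t)) →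
    ENNReal.ofReal (1 - δ) ≤
      P {ω | decentralizationCost T (μAgent ω) (μCentral ω) ≤ bound m T}

end DistributedDetection

end

/-!
Beliefs are Gibbs distributions of the potentials `η • φ`, and the divergence between two Gibbs
distributions `p`, `q` with potentials `a`, `b` is at most the Jeffreys divergence
`∑ k, (p k - q k) * (a k - b k)`. It is therefore small when the potentials are close, and
exponentially small once both of them favour the true state clearly.

Closeness at all times is a matter of mixing: `φ_{i,t}` and `φ_t` differ by at most `B` times the
summed `ℓ¹` distance of the rows of `W ^ s` to the stationary distribution. Separation holds by
Hoeffding's inequality after about `log (n m T) / η` rounds, each of which costs at most a multiple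
of `η` times the summed distance.

It remains to bound the summed distance by a constant over the spectral gap. On the star and the
cycle the spectral resolution of `W ^ s` does this; on the cycle because the sum of
`1 / (1 - |λ_a|)` over the frequencies `a` converges like `∑ a, n ^ 2 / a ^ 2`. On the torus the
same sum over pairs of frequencies would lose a logarithm. Instead, its walk moves in one of the two
coordinates according to a fair coin, so its powers are binomial averages of products of powers of
two cycle walks.
-/

namespace DistributedDetection

/-! ### Gibbs distributions and beliefs -/

section Gibbs

variable {α : Type*} [Fintype α]

/-- The logarithm of the partition function of the potential `a`, the normalization of `gibbs a`. -/
noncomputable def logPartition (a : α → ℝ) : ℝ := Real.log (∑ l, Real.exp (a l))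

/-- The Gibbs distribution with potential `a`, to which the beliefs of both algorithms belong. -/
noncomputable def gibbs (a : α → ℝ) (k : α) : ℝ := Real.exp (a k - logPartition a)

lemma gibbs_pos (a : α → ℝ) (k : α) : 0 < gibbs a k := Real.exp_pos _

lemma log_gibbs (a : α → ℝ) (k : α) : Real.log (gibbs a k) = a k - logPartition a :=
  Real.log_exp _

lemma exp_logPartition [Nonempty α] (a : α → ℝ) :
    Real.exp (logPartition a) = ∑ l, Real.exp (a l) :=
  Real.exp_log (Finset.sum_pos (fun _ _ => Real.exp_pos _) Finset.univ_nonempty)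

lemma sum_gibbs [Nonempty α] (a : α → ℝ) : ∑ k, gibbs a k = 1 := by
  simp only [gibbs, Real.exp_sub, ← Finset.sum_div]
  rw [← exp_logPartition, div_self (Real.exp_pos _).ne']

lemma gibbs_mem_stdSimplex [Nonempty α] (a : α → ℝ) : gibbs a ∈ stdSimplex ℝ α :=
  ⟨fun k => (gibbs_pos a k).le, sum_gibbs a⟩

lemma le_logPartition (a : α → ℝ) (k : α) : a k ≤ logPartition a := by
  have : Nonempty α := ⟨k⟩
  rw [← Real.exp_le_exp, exp_logPartition]
  exact Finset.single_le_sum (f := fun l => Real.exp (a l)) (fun _ _ => (Real.exp_pos _).le)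
    (Finset.mem_univ k)

lemma gibbs_le_exp_neg {a : α → ℝ} {k l : α} {L : ℝ} (h : a k - a l ≤ -L) :
    gibbs a k ≤ Real.exp (-L) :=
  Real.exp_le_exp.2 <| by linarith [le_logPartition a l]

end Gibbs

section KullbackLeibler

variable {m : ℕ} {p q : Fin m → ℝ}

lemma klVec_eq_sum_klFun (hq : ∀ k, 0 < q k) (hpq : ∑ k, p k = ∑ k, q k) :
    klVec p q = ∑ k, q k * InformationTheory.klFun (p k / q k) := by
  have hterm (k : Fin m) : q k * InformationTheory.klFun (p k / q k) =
      p k * Real.log (p k / q k) + (q k - p k) := by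
    have := (hq k).ne'
    rw [InformationTheory.klFun]
    field_simp
    ring
  simp only [hterm, Finset.sum_add_distrib, Finset.sum_sub_distrib, hpq, sub_self, add_zero, klVec]

lemma klVec_nonneg (hp : ∀ k, 0 ≤ p k) (hq : ∀ k, 0 < q k) (hpq : ∑ k, p k = ∑ k, q k) :
    0 ≤ klVec p q := by
  rw [klVec_eq_sum_klFun hq hpq]
  exact Finset.sum_nonneg fun k _ =>
    mul_nonneg (hq k).le (InformationTheory.klFun_nonneg (div_nonneg (hp k) (hq k).le))

lemma eq_of_klVec_nonpos (hp : ∀ k, 0 ≤ p k) (hq : ∀ k, 0 < q k) (hpq : ∑ k, p k = ∑ k, q k)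
    (h : klVec p q ≤ 0) : p = q := by
  have hdiv (k : Fin m) : 0 ≤ p k / q k := div_nonneg (hp k) (hq k).le
  have hsum := le_antisymm h (klVec_nonneg hp hq hpq)
  rw [klVec_eq_sum_klFun hq hpq, Finset.sum_eq_zero_iff_of_nonneg fun k _ =>
    mul_nonneg (hq k).le (InformationTheory.klFun_nonneg (hdiv k))] at hsum
  funext k
  have hk := (mul_eq_zero.1 (hsum k (Finset.mem_univ k))).resolve_left (hq k).ne'
  rw [InformationTheory.klFun_eq_zero_iff (hdiv k)] at hk
  exact (div_eq_one_iff_eq (hq k).ne').1 hk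

lemma klVec_gibbs_right (hp : ∑ k, p k = 1) (a : Fin m → ℝ) :
    klVec p (gibbs a) = ∑ k, p k * Real.log (p k) - ∑ k, p k * a k + logPartition a := by
  have hterm (k : Fin m) : p k * Real.log (p k / gibbs a k) =
      p k * Real.log (p k) - p k * a k + p k * logPartition a := by
    rcases eq_or_ne (p k) 0 with h | h
    · simp [h]
    · rw [Real.log_div h (gibbs_pos a k).ne', log_gibbs]
      ring
  simp only [klVec, hterm, Finset.sum_add_distrib, Finset.sum_sub_distrib, ← Finset.sum_mul, hp,
    one_mul]

variable [NeZero m]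

lemma gibbs_zero : gibbs (0 : Fin m → ℝ) = fun _ => 1 / (m : ℝ) := by
  funext k
  rw [gibbs, Real.exp_sub, exp_logPartition]
  simp

lemma IsBelief.eq_gibbs {η : ℝ} (hη : 0 < η) {φ μ : Fin m → ℝ} (h : IsBelief η φ μ) :
    μ = gibbs (η • φ) := by
  have objective_eq {p : Fin m → ℝ} (hp : ∑ k, p k = 1) :
      -(∑ k, p k * φ k) + 1 / η * klVec p (fun _ => 1 / (m : ℝ)) =
        1 / η * (klVec p (gibbs (η • φ)) +
          (logPartition (0 : Fin m → ℝ) - logPartition (η • φ))) := by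
    have hlin : ∑ k, p k * (η • φ) k = η * ∑ k, p k * φ k := by
      simp only [Pi.smul_apply, smul_eq_mul, Finset.mul_sum, mul_left_comm]
    simp only [← gibbs_zero, klVec_gibbs_right hp, hlin, Pi.zero_apply, mul_zero,
      Finset.sum_const_zero]
    field_simp
    ring
  have hself : klVec (gibbs (η • φ)) (gibbs (η • φ)) = 0 :=
    Finset.sum_eq_zero fun k _ => by simp [div_self (gibbs_pos (η • φ) k).ne']
  have hmin := h.isMinOn (gibbs_mem_stdSimplex (η • φ))
  simp only [Set.mem_ofPred_eq] at hmin
  rw [objective_eq h.mem_simplex.2, objective_eq (sum_gibbs _), hself] at hmin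
  have := le_of_mul_le_mul_left hmin (one_div_pos.2 hη)
  exact eq_of_klVec_nonpos h.mem_simplex.1 (gibbs_pos _)
    (h.mem_simplex.2.trans (sum_gibbs _).symm) (by linarith)

/-- The divergence is at most its symmetrization, in which the partition functions cancel. -/
lemma klVec_gibbs_le_sum (a b : Fin m → ℝ) :
    klVec (gibbs a) (gibbs b) ≤ ∑ k, (gibbs a k - gibbs b k) * (a k - b k) := by
  have hsymm : klVec (gibbs a) (gibbs b) + klVec (gibbs b) (gibbs a) =
      ∑ k, (gibbs a k - gibbs b k) * (a k - b k) := by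
    simp only [klVec_gibbs_right (sum_gibbs _), log_gibbs, sub_mul, mul_sub,
      Finset.sum_sub_distrib, ← Finset.sum_mul, sum_gibbs]
    ring
  have := klVec_nonneg (fun k => (gibbs_pos b k).le) (gibbs_pos a)
    ((sum_gibbs b).trans (sum_gibbs a).symm)
  linarith

variable {a b : Fin m → ℝ} {d : ℝ}

lemma klVec_gibbs_le (h : ∀ k, |a k - b k| ≤ d) : klVec (gibbs a) (gibbs b) ≤ 2 * d := by
  calc klVec (gibbs a) (gibbs b) ≤ ∑ k, (gibbs a k - gibbs b k) * (a k - b k) :=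
        klVec_gibbs_le_sum a b
    _ ≤ ∑ k, (gibbs a k + gibbs b k) * d := by
        refine Finset.sum_le_sum fun k _ => ?_
        have := abs_le.1 (h k)
        nlinarith [gibbs_pos a k, gibbs_pos b k]
    _ = 2 * d := by
        rw [← Finset.sum_mul, Finset.sum_add_distrib, sum_gibbs, sum_gibbs]
        ring

lemma klVec_gibbs_le_of_gap (θ : Fin m) {L : ℝ} (h : ∀ k, |a k - b k| ≤ d)
    (ha : ∀ k, k ≠ θ → a k - a θ ≤ -L) (hb : ∀ k, k ≠ θ → b k - b θ ≤ -L) :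
    klVec (gibbs a) (gibbs b) ≤ m * Real.exp (-L) * (4 * d) := by
  have hd : 0 ≤ d := (abs_nonneg _).trans (h θ)
  -- As the weights have equal sums, the difference at `θ` may be subtracted from all of them.
  have hshift : ∑ k, (gibbs a k - gibbs b k) * (a k - b k) =
      ∑ k, (gibbs a k - gibbs b k) * ((a k - b k) - (a θ - b θ)) := by
    simp only [mul_sub _ (a _ - b _) (a θ - b θ), Finset.sum_sub_distrib, ← Finset.sum_mul,
      sum_gibbs, sub_self, zero_mul, sub_zero]
  have hterm (k : Fin m) : (gibbs a k - gibbs b k) * ((a k - b k) - (a θ - b θ)) ≤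
      Real.exp (-L) * (4 * d) := by
    rcases eq_or_ne k θ with rfl | hk
    · rw [sub_self, mul_zero]
      positivity
    · have hdiff : |(a k - b k) - (a θ - b θ)| ≤ 2 * d :=
        (abs_sub _ _).trans (by linarith [h k, h θ])
      have := abs_le.1 hdiff
      have := gibbs_le_exp_neg (ha k hk)
      have := gibbs_le_exp_neg (hb k hk)
      have := gibbs_pos a k
      have := gibbs_pos b k
      nlinarith
  calc klVec (gibbs a) (gibbs b)
      ≤ ∑ k, (gibbs a k - gibbs b k) * ((a k - b k) - (a θ - b θ)) :=
        hshift ▸ klVec_gibbs_le_sum a b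
    _ ≤ ∑ _k : Fin m, Real.exp (-L) * (4 * d) := Finset.sum_le_sum fun k _ => hterm k
    _ = m * Real.exp (-L) * (4 * d) := by
        rw [Finset.sum_const, Finset.card_univ, Fintype.card_fin, nsmul_eq_mul, mul_assoc]

end KullbackLeibler

/-! ### Concentration of the centralized log-likelihood ratios -/

lemma centralPhi_eq_sum {V : Type} [Fintype V] {m : ℕ} (π : V → ℝ) (ψ : ℕ → V → Fin m → ℝ)
    (t : ℕ) (k : Fin m) :
    centralPhi π ψ t k = ∑ τ ∈ Finset.Icc 1 t, ∑ i, π i * ψ τ i k := by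
  induction t with
  | zero => simp [centralPhi]
  | succ t ih => rw [Finset.sum_Icc_succ_top (by omega), ← ih]; rfl

lemma hasSubgaussianMGF_sub_integral_of_abs_le {Ω : Type*} [MeasurableSpace Ω] {P : Measure Ω}
    [IsProbabilityMeasure P] {X : Ω → ℝ} {b : ℝ} {c : NNReal} (hX : AEMeasurable X P)
    (hb : ∀ ω, |X ω| ≤ b) (hbc : b ^ 2 ≤ c) :
    HasSubgaussianMGF (fun ω => X ω - P[X]) c P := by
  have h := hasSubgaussianMGF_of_mem_Icc hX (ae_of_all P fun ω => abs_le.1 (hb ω))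
  have hc : (((‖b - -b‖₊ / 2) ^ 2 : NNReal) : ℝ) = b ^ 2 := by
    simp only [NNReal.coe_pow, NNReal.coe_div, coe_nnnorm, NNReal.coe_ofNat, Real.norm_eq_abs,
      div_pow, sq_abs]
    ring
  refine ⟨h.integrable_exp_mul, fun t => (h.mgf_le t).trans (Real.exp_le_exp.2 ?_)⟩
  rw [hc]
  gcongr

namespace SignalModel

variable {V : Type} {m : ℕ}

/-- The log-likelihood ratio of the state `k` against the state `θ` for a signal of agent `i`; its
mean under `θ` is minus the divergence of the two laws. -/
noncomputable def logRatio (M : SignalModel.{u} V m) (i : V) (θ k : Fin m) (x : M.S i) : ℝ :=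
  Real.log (M.lik i k x) - Real.log (M.lik i θ x)

lemma measurable_logRatio (M : SignalModel.{u} V m) (i : V) (θ k : Fin m) :
    Measurable (M.logRatio i θ k) :=
  (M.lik_measurable i k).log.sub (M.lik_measurable i θ).log

lemma centralPhi_logLik_sub [Fintype V] (M : SignalModel.{u} V m) (π : V → ℝ)
    (s : ℕ → ∀ i, M.S i) (t : ℕ) (θ k : Fin m) :
    centralPhi π (M.logLik s) t k - centralPhi π (M.logLik s) t θ =
      ∑ τ ∈ Finset.Icc 1 t, ∑ i, π i * M.logRatio i θ k (s τ i) := by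
  simp only [centralPhi_eq_sum, ← Finset.sum_sub_distrib, ← mul_sub]
  rfl

lemma isProbabilityMeasure_law (M : SignalModel.{u} V m) (i : V) (k : Fin m) :
    IsProbabilityMeasure (M.law i k) :=
  ⟨by rw [law, withDensity_apply _ MeasurableSet.univ, setLIntegral_univ, M.lik_normalized]⟩

variable {M : SignalModel.{u} V m} {B : ℝ}

namespace LogBounded

lemma abs_logRatio_le (h : M.LogBounded B) (i : V) (θ k : Fin m) (x : M.S i) :
    |M.logRatio i θ k x| ≤ 2 * B :=
  (abs_sub _ _).trans (by linarith [(h i k x).2, (h i θ x).2])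

lemma law_eq_withDensity (h : M.LogBounded B) (i : V) (θ k : Fin m) :
    M.law i θ = (M.law i k).withDensity fun x => ENNReal.ofReal (M.lik i θ x / M.lik i k x) := by
  have hθ := M.lik_measurable i θ
  have hk := M.lik_measurable i k
  have hdiv : Measurable fun x => M.lik i θ x / M.lik i k x := hθ.div hk
  rw [law, law, ← withDensity_mul _ hk.ennreal_ofReal hdiv.ennreal_ofReal]
  congr 1
  funext x
  have := (h i k x).1
  rw [Pi.mul_apply, ← ENNReal.ofReal_mul this.le, mul_div_cancel₀ _ this.ne']

lemma integral_logRatio (h : M.LogBounded B) (i : V) (θ k : Fin m) :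
    ∫ x, M.logRatio i θ k x ∂(M.law i θ) =
      -(InformationTheory.klDiv (M.law i θ) (M.law i k)).toReal := by
  have := M.isProbabilityMeasure_law i θ
  have := M.isProbabilityMeasure_law i k
  have hac : M.law i θ ≪ M.law i k := by
    rw [h.law_eq_withDensity i θ k]
    exact withDensity_absolutelyContinuous _ _
  have hdiv : Measurable fun x => M.lik i θ x / M.lik i k x :=
    (M.lik_measurable i θ).div (M.lik_measurable i k)
  rw [InformationTheory.toReal_klDiv_of_measure_eq hac (by simp), ← integral_neg]
  refine integral_congr_ae (hac.ae_le ?_)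
  filter_upwards [Measure.rnDeriv_withDensity (M.law i k) hdiv.ennreal_ofReal] with x hx
  have h1 := (h i θ x).1
  have h2 := (h i k x).1
  rw [llr, h.law_eq_withDensity i θ k, hx, ENNReal.toReal_ofReal (div_pos h1 h2).le,
    Real.log_div h1.ne' h2.ne', logRatio, neg_sub]

end LogBounded

namespace IsSignalSequence

variable {Ω : Type v} [MeasurableSpace Ω] {P : Measure Ω} {s : ℕ → ∀ i, Ω → M.S i} {θ : Fin m}
  {T : ℕ}

lemma mono (hs : M.IsSignalSequence θ T P s) {t : ℕ} (h : t ≤ T) :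
    M.IsSignalSequence θ t P s where
  hasLaw τ hτ := hs.hasLaw τ (Set.Icc_subset_Icc_right h hτ)
  indep := hs.indep.precomp (g := Prod.map (Set.inclusion (Set.Icc_subset_Icc_right h)) id)
    ((Set.inclusion_injective _).prodMap Function.injective_id)

lemma integral_logRatio (hM : M.LogBounded B) (hs : M.IsSignalSequence θ T P s) (k : Fin m)
    (p : Set.Icc 1 T × V) :
    ∫ ω, M.logRatio p.2 θ k (s p.1 p.2 ω) ∂P =
      -(InformationTheory.klDiv (M.law p.2 θ) (M.law p.2 k)).toReal :=
  ((hs.hasLaw p.1 p.1.2 p.2).integral_comp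
    (M.measurable_logRatio p.2 θ k).aestronglyMeasurable).trans (hM.integral_logRatio p.2 θ k)

variable [Fintype V] [IsProbabilityMeasure P]

lemma measure_sum_logRatio_ge_le (hM : M.LogBounded B) (hs : M.IsSignalSequence θ T P s)
    {π : V → ℝ} (hπ : ∀ i, 0 ≤ π i) (hπ1 : ∑ i, π i = 1) (k : Fin m) {ε : ℝ} (hε : 0 ≤ ε) :
    P.real {ω | ε ≤ ∑ p : Set.Icc 1 T × V, π p.2 * (M.logRatio p.2 θ k (s p.1 p.2 ω) +
      (InformationTheory.klDiv (M.law p.2 θ) (M.law p.2 k)).toReal)} ≤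
      Real.exp (-ε ^ 2 / (2 * (4 * B ^ 2 * T))) := by
  let X (p : Set.Icc 1 T × V) (ω : Ω) : ℝ := π p.2 * M.logRatio p.2 θ k (s p.1 p.2 ω)
  have hX (p : Set.Icc 1 T × V) : Measurable fun x => π p.2 * M.logRatio p.2 θ k x :=
    (M.measurable_logRatio p.2 θ k).const_mul _
  have hmean (p) : P[X p] =
      -(π p.2 * (InformationTheory.klDiv (M.law p.2 θ) (M.law p.2 k)).toReal) := by
    rw [integral_const_mul, hs.integral_logRatio hM, mul_neg]
  have hbound (p ω) : |X p ω| ≤ π p.2 * (2 * B) := by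
    rw [abs_mul, abs_of_nonneg (hπ p.2)]
    exact mul_le_mul_of_nonneg_left (hM.abs_logRatio_le ..) (hπ p.2)
  have hπ_le (i : V) : π i ≤ 1 := hπ1 ▸ Finset.single_le_sum (fun i _ => hπ i) (Finset.mem_univ i)
  -- With `π i ^ 2 ≤ π i`, the variance proxies add up to `4 * B ^ 2 * T`.
  let c (p : Set.Icc 1 T × V) : NNReal := (4 * B ^ 2 * π p.2).toNNReal
  have hc (p) : (c p : ℝ) = 4 * B ^ 2 * π p.2 :=
    Real.coe_toNNReal _ (mul_nonneg (by positivity) (hπ p.2))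
  have hsub (p) : HasSubgaussianMGF (fun ω => X p ω - P[X p]) (c p) P := by
    refine hasSubgaussianMGF_sub_integral_of_abs_le
      ((hX p).comp_aemeasurable (hs.hasLaw p.1 p.1.2 p.2).aemeasurable) (hbound p) ?_
    rw [hc]
    nlinarith [mul_nonneg (mul_nonneg (hπ p.2) (sub_nonneg.2 (hπ_le p.2))) (sq_nonneg B)]
  have hindep : iIndepFun (fun p ω => X p ω - P[X p]) P :=
    hs.indep.comp (fun p x => π p.2 * M.logRatio p.2 θ k x - ∫ ω, X p ω ∂P)
      fun p => (hX p).sub_const _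
  have hsum : ((∑ p, c p : NNReal) : ℝ) = 4 * B ^ 2 * T := by
    simp only [NNReal.coe_sum, hc, Fintype.sum_prod_type, ← Finset.mul_sum, hπ1, mul_one]
    simp [mul_assoc, mul_comm]
  have h := HasSubgaussianMGF.measure_sum_ge_le_of_iIndepFun hindep (s := Finset.univ)
    (fun p _ => hsub p) hε
  simpa only [hsum, hmean, X, sub_neg_eq_add, ← mul_add] using h

lemma measure_centralPhi_sub_ge_le (hM : M.LogBounded B) (hs : M.IsSignalSequence θ T P s)
    {π : V → ℝ} (hπ : ∀ i, 0 ≤ π i) (hπ1 : ∑ i, π i = 1) {k : Fin m} {ι : ℝ} (hι : 0 ≤ ι)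
    (hinfo : ι ≤ M.info π θ k) :
    P {ω | -(T * ι / 2) ≤ centralPhi π (M.logLik fun t i => s t i ω) T k -
        centralPhi π (M.logLik fun t i => s t i ω) T θ} ≤
      ENNReal.ofReal (Real.exp (-(T * ι ^ 2 / (32 * B ^ 2)))) := by
  have hcentral (ω : Ω) : ∑ p : Set.Icc 1 T × V, π p.2 * (M.logRatio p.2 θ k (s p.1 p.2 ω) +
      (InformationTheory.klDiv (M.law p.2 θ) (M.law p.2 k)).toReal) =
      centralPhi π (M.logLik fun t i => s t i ω) T k -
        centralPhi π (M.logLik fun t i => s t i ω) T θ + T * M.info π θ k := by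
    rw [centralPhi_logLik_sub, Fintype.sum_prod_type]
    simp only [mul_add, Finset.sum_add_distrib]
    congr 1
    · exact (Finset.sum_subtype (Finset.Icc 1 T) (fun _ => Finset.mem_Icc)
        fun τ => ∑ i, π i * M.logRatio i θ k (s τ i ω)).symm
    · exact (Finset.sum_const (M.info π θ k)).trans (by simp)
  have hexponent : -(T * ι / 2) ^ 2 / (2 * (4 * B ^ 2 * T)) = -(T * ι ^ 2 / (32 * B ^ 2)) := by
    rcases eq_or_ne (T : ℝ) 0 with hT | hT
    · simp [hT]
    rcases eq_or_ne B 0 with rfl | hB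
    · simp
    field_simp
    ring
  rw [← hexponent, ← ofReal_measureReal]
  refine ENNReal.ofReal_le_ofReal ((measureReal_mono fun ω hω => ?_).trans
    (hs.measure_sum_logRatio_ge_le hM hπ hπ1 k (by positivity)))
  simp only [Set.mem_ofPred_eq, hcentral] at hω ⊢
  nlinarith [mul_le_mul_of_nonneg_left hinfo T.cast_nonneg]

end IsSignalSequence
end SignalModel

/-- From round `t₁` on, the potentials `φ` separate the state `θ` from all others by half of the
gap `t * ι` that is expected in round `t`. -/
def IsSeparated {m : ℕ} (θ : Fin m) (T : ℕ) (t₁ ι : ℝ) (φ : ℕ → Fin m → ℝ) : Prop :=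
  ∀ t ∈ Finset.Icc 1 T, t₁ ≤ t → ∀ k, k ≠ θ → φ t k - φ t θ ≤ -(t * ι / 2)

lemma SignalModel.IsSignalSequence.measure_not_isSeparated_le {V : Type} [Fintype V] {m T : ℕ}
    {M : SignalModel.{u} V m} {Ω : Type v} [MeasurableSpace Ω] {P : Measure Ω}
    [IsProbabilityMeasure P] {s : ℕ → ∀ i, Ω → M.S i} {θ : Fin m} {B ι Λ : ℝ} (hB : 0 < B)
    (hι : 0 < ι) (hM : M.LogBounded B) (hs : M.IsSignalSequence θ T P s) {π : V → ℝ}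
    (hπ : ∀ i, 0 ≤ π i) (hπ1 : ∑ i, π i = 1) (hinfo : ∀ k, k ≠ θ → ι ≤ M.info π θ k) :
    P {ω | ¬IsSeparated θ T (32 * B ^ 2 * Λ / ι ^ 2) ι
      (centralPhi π (M.logLik fun t i => s t i ω))} ≤
      ENNReal.ofReal (T * m * Real.exp (-Λ)) := by
  let bad (t : ℕ) (k : Fin m) : Set Ω := {ω | 32 * B ^ 2 * Λ / ι ^ 2 ≤ t ∧ k ≠ θ ∧
    -(t * ι / 2) ≤ centralPhi π (M.logLik fun t i => s t i ω) t k -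
      centralPhi π (M.logLik fun t i => s t i ω) t θ}
  have hbad (t) (ht : t ∈ Finset.Icc 1 T) (k) : P (bad t k) ≤ ENNReal.ofReal (Real.exp (-Λ)) := by
    by_cases h : 32 * B ^ 2 * Λ / ι ^ 2 ≤ t ∧ k ≠ θ
    · refine (measure_mono fun ω hω => hω.2.2).trans
        (((hs.mono (Finset.mem_Icc.1 ht).2).measure_centralPhi_sub_ge_le hM hπ hπ1 hι.le
          (hinfo k h.2)).trans (ENNReal.ofReal_le_ofReal (Real.exp_le_exp.2 ?_)))
      have := h.1
      rw [div_le_iff₀ (by positivity)] at this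
      rw [neg_le_neg_iff, le_div_iff₀ (by positivity)]
      linarith
    · have hempty : bad t k = ∅ := Set.eq_empty_of_forall_notMem fun ω hω => h ⟨hω.1, hω.2.1⟩
      simp [hempty]
  calc P {ω | ¬IsSeparated θ T (32 * B ^ 2 * Λ / ι ^ 2) ι
        (centralPhi π (M.logLik fun t i => s t i ω))}
      ≤ P (⋃ t ∈ Finset.Icc 1 T, ⋃ k ∈ (Finset.univ : Finset (Fin m)), bad t k) := by
        refine measure_mono fun ω hω => ?_
        simp only [IsSeparated, Set.mem_ofPred_eq] at hω
        push Not at hω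
        obtain ⟨t, ht, htt, k, hk, hlt⟩ := hω
        simp only [Set.mem_iUnion]
        exact ⟨t, ht, k, Finset.mem_univ k, htt, hk, hlt.le⟩
    _ ≤ ∑ t ∈ Finset.Icc 1 T, ∑ k, P (bad t k) :=
        (measure_biUnion_finset_le _ _).trans
          (Finset.sum_le_sum fun _ _ => measure_biUnion_finset_le _ _)
    _ ≤ ∑ _t ∈ Finset.Icc 1 T, ∑ _k : Fin m, ENNReal.ofReal (Real.exp (-Λ)) :=
        Finset.sum_le_sum fun t ht => Finset.sum_le_sum fun k _ => hbad t ht k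
    _ = ENNReal.ofReal (T * m * Real.exp (-Λ)) := by
        simp [ENNReal.ofReal_mul, mul_assoc]

/-! ### Mixing of the communication matrix -/

lemma centralPhi_eq_sum_range {V : Type} [Fintype V] {m : ℕ} (π : V → ℝ) (ψ : ℕ → V → Fin m → ℝ)
    (t : ℕ) (k : Fin m) :
    centralPhi π ψ t k = ∑ s ∈ Finset.range t, ∑ j, π j * ψ (t - s) j k := by
  induction t with
  | zero => simp [centralPhi]
  | succ t ih =>
    rw [Finset.sum_range_succ']
    simp only [Nat.add_sub_add_right, ← ih]
    rfl

section Mixing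

variable {V : Type} [Fintype V] [DecidableEq V] {W : Matrix V V ℝ}

lemma agentPhi_eq_sum_range {m : ℕ} (W : Matrix V V ℝ) (ψ : ℕ → V → Fin m → ℝ) (t : ℕ) (i : V)
    (k : Fin m) :
    agentPhi W ψ t i k = ∑ s ∈ Finset.range t, ∑ j, (W ^ s) i j * ψ (t - s) j k := by
  induction t generalizing i with
  | zero => simp [agentPhi]
  | succ t ih =>
    have hstep : ∑ j, W i j * agentPhi W ψ t j k =
        ∑ s ∈ Finset.range t, ∑ j, (W ^ (s + 1)) i j * ψ (t - s) j k := by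
      simp only [ih, Finset.mul_sum, pow_succ', Matrix.mul_apply, Finset.sum_mul, mul_assoc]
      rw [Finset.sum_comm]
      exact Finset.sum_congr rfl fun s _ => Finset.sum_comm
    change ∑ j, W i j * agentPhi W ψ t j k + ψ (t + 1) i k = _
    rw [hstep, Finset.sum_range_succ']
    simp [Matrix.one_apply]

/-- The rows of the powers of `W` converge to `ρ`, with a total `ℓ¹` error of at most `S`. -/
def MixesWithin (W : Matrix V V ℝ) (ρ : V → ℝ) (S : ℝ) : Prop :=
  ∀ i t, ∑ s ∈ Finset.range t, ∑ j, |(W ^ s) i j - ρ j| ≤ S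

lemma IsCentrality.sum_mul_pow {π : V → ℝ} (hπ : IsCentrality W π) (s : ℕ) (j : V) :
    ∑ i, π i * (W ^ s) i j = π j := by
  have hstep : Matrix.vecMul π W = π := by
    funext j
    simp only [Matrix.vecMul, dotProduct, mul_comm (π _)]
    exact (hπ.stationary j).symm
  have hpow : Matrix.vecMul π (W ^ s) = π := by
    induction s with
    | zero => simp
    | succ s ih => rw [pow_succ, ← Matrix.vecMul_vecMul, ih, hstep]
  exact congrFun hpow j

namespace MixesWithin

variable {ρ : V → ℝ} {S : ℝ}

lemma mono (hW : MixesWithin W ρ S) {S' : ℝ} (h : S ≤ S') : MixesWithin W ρ S' :=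
  fun i t => (hW i t).trans h

lemma abs_agentPhi_sub_centralPhi_le (hW : MixesWithin W ρ S) {m : ℕ} {B : ℝ} (hB : 0 ≤ B)
    {ψ : ℕ → V → Fin m → ℝ} (hψ : ∀ t i k, |ψ t i k| ≤ B) (t : ℕ) (i : V) (k : Fin m) :
    |agentPhi W ψ t i k - centralPhi ρ ψ t k| ≤ B * S := by
  rw [agentPhi_eq_sum_range, centralPhi_eq_sum_range, ← Finset.sum_sub_distrib]
  simp only [← Finset.sum_sub_distrib, ← sub_mul]
  calc |∑ s ∈ Finset.range t, ∑ j, ((W ^ s) i j - ρ j) * ψ (t - s) j k|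
      ≤ ∑ s ∈ Finset.range t, ∑ j, |((W ^ s) i j - ρ j) * ψ (t - s) j k| :=
        (Finset.abs_sum_le_sum_abs _ _).trans
          (Finset.sum_le_sum fun _ _ => Finset.abs_sum_le_sum_abs _ _)
    _ ≤ ∑ s ∈ Finset.range t, ∑ j, B * |(W ^ s) i j - ρ j| := by
        gcongr with s _ j _
        rw [abs_mul, mul_comm]
        exact mul_le_mul_of_nonneg_right (hψ _ _ _) (abs_nonneg _)
    _ ≤ B * S := by
        simp only [← Finset.mul_sum]
        exact mul_le_mul_of_nonneg_left (hW i t) hB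

lemma tendsto_pow_apply (hW : MixesWithin W ρ S) (i j : V) :
    Filter.Tendsto (fun s => (W ^ s) i j) Filter.atTop (nhds (ρ j)) := by
  have hsum : Summable fun s => |(W ^ s) i j - ρ j| :=
    summable_of_sum_range_le (fun _ => abs_nonneg _) fun t =>
      (Finset.sum_le_sum fun s _ => Finset.single_le_sum (f := fun j => |(W ^ s) i j - ρ j|)
        (fun _ _ => abs_nonneg _) (Finset.mem_univ j)).trans (hW i t)
  simpa using (tendsto_zero_iff_abs_tendsto_zero _ |>.2 hsum.tendsto_atTop_zero).add_const (ρ j)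

end MixesWithin

lemma IsCentrality.eq_of_mixesWithin {π ρ : V → ℝ} {S : ℝ} (hπ : IsCentrality W π)
    (hW : MixesWithin W ρ S) : π = ρ := by
  funext j
  have hlim : Filter.Tendsto (fun s => ∑ i, π i * (W ^ s) i j) Filter.atTop (nhds (ρ j)) := by
    simpa [← Finset.sum_mul, hπ.sum_eq_one] using
      tendsto_finsetSum Finset.univ fun i _ => (hW.tendsto_pow_apply i j).const_mul (π i)
  simp only [hπ.sum_mul_pow] at hlim
  exact tendsto_nhds_unique tendsto_const_nhds hlim

end Mixing

/-! ### The spectral gap -/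

section SpectralGap

variable {V : Type} [Fintype V] [DecidableEq V] {W : Matrix V V ℝ}

lemma mem_spectrum_iff_exists_mulVec_eq_smul {A : Matrix V V ℂ} {z : ℂ} :
    z ∈ spectrum ℂ A ↔ ∃ v : V → ℂ, v ≠ 0 ∧ A.mulVec v = z • v := by
  rw [← Matrix.spectrum_toLin', ← Module.End.hasEigenvalue_iff_mem_spectrum]
  constructor
  · intro h
    obtain ⟨v, hv⟩ := h.exists_hasEigenvector
    exact ⟨v, hv.2, by simpa using hv.apply_eq_smul⟩
  · rintro ⟨v, hv, h⟩
    exact Module.End.hasEigenvalue_of_hasEigenvector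
      (Module.End.hasEigenvector_iff.2 ⟨Module.End.mem_eigenspace_iff.2 (by simpa using h), hv⟩)

lemma finite_setOf_norm_mem_spectrum (W : Matrix V V ℝ) :
    {x : ℝ | ∃ z ∈ spectrum ℂ (W.map ((↑) : ℝ → ℂ)), z ≠ 1 ∧ x = ‖z‖}.Finite := by
  have hspec : (spectrum ℂ (W.map ((↑) : ℝ → ℂ))).Finite := by
    rw [← Matrix.spectrum_toLin']
    exact Module.End.finite_spectrum _
  refine (hspec.image norm).subset ?_
  rintro x ⟨z, hz, _, rfl⟩
  exact ⟨z, hz, rfl⟩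

lemma spectralGap_le_one (W : Matrix V V ℝ) : spectralGap W ≤ 1 :=
  sub_le_self _ (Real.sSup_nonneg fun _ ⟨z, _, _, hx⟩ => hx ▸ norm_nonneg z)

lemma spectralGap_le_of_mulVec_eq_smul {z : ℂ} (hz : z ≠ 1) {v : V → ℂ} (hv : v ≠ 0)
    (h : (W.map ((↑) : ℝ → ℂ)).mulVec v = z • v) : spectralGap W ≤ 1 - ‖z‖ :=
  sub_le_sub_left (le_csSup (finite_setOf_norm_mem_spectrum W).bddAbove
    ⟨z, mem_spectrum_iff_exists_mulVec_eq_smul.2 ⟨v, hv, h⟩, hz, rfl⟩) 1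

lemma MixesWithin.norm_lt_one {ρ : V → ℝ} {S : ℝ} (hW : MixesWithin W ρ S) {z : ℂ} (hz : z ≠ 1)
    {v : V → ℂ} (hv : v ≠ 0) (h : (W.map ((↑) : ℝ → ℂ)).mulVec v = z • v) : ‖z‖ < 1 := by
  have hpow (s : ℕ) : (W.map ((↑) : ℝ → ℂ) ^ s).mulVec v = z ^ s • v := by
    induction s with
    | zero => simp
    | succ s ih =>
      rw [pow_succ, ← Matrix.mulVec_mulVec, h, Matrix.mulVec_smul, ih, smul_smul, pow_succ']
  have hmap (s : ℕ) : W.map ((↑) : ℝ → ℂ) ^ s = (W ^ s).map ((↑) : ℝ → ℂ) :=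
    (map_pow Complex.ofRealHom.mapMatrix W s).symm
  simp only [hmap] at hpow
  obtain ⟨i, hi⟩ := Function.ne_iff.1 hv
  have hconv : Filter.Tendsto (fun s => z ^ s * v i) Filter.atTop
      (nhds (∑ j, (ρ j : ℂ) * v j)) := by
    have hentry (s : ℕ) : z ^ s * v i = ∑ j, ((W ^ s) i j : ℂ) * v j := (congrFun (hpow s) i).symm
    simp only [hentry]
    exact tendsto_finsetSum _ fun j _ =>
      ((Complex.continuous_ofReal.tendsto _).comp (hW.tendsto_pow_apply i j)).mul_const _
  -- Consecutive powers become close, although they differ by the factor `z - 1`.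
  have hdiff : Filter.Tendsto (fun s => z ^ s * ((z - 1) * v i)) Filter.atTop (nhds 0) := by
    simpa only [sub_self, pow_succ, mul_assoc, ← mul_sub, ← sub_one_mul] using
      ((Filter.tendsto_add_atTop_iff_nat 1).2 hconv).sub hconv
  have hne : (z - 1) * v i ≠ 0 := mul_ne_zero (sub_ne_zero.2 hz) hi
  rw [← tendsto_pow_atTop_nhds_zero_iff_norm_lt_one]
  simpa only [mul_inv_cancel_right₀ hne, zero_mul] using hdiff.mul_const ((z - 1) * v i)⁻¹

lemma MixesWithin.spectralGap_pos {ρ : V → ℝ} {S : ℝ} (hW : MixesWithin W ρ S) :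
    0 < spectralGap W := by
  rw [spectralGap, sub_pos, secondModulus]
  rcases Set.eq_empty_or_nonempty
    {x : ℝ | ∃ z ∈ spectrum ℂ (W.map ((↑) : ℝ → ℂ)), z ≠ 1 ∧ x = ‖z‖} with hempty | hne
  · rw [hempty, Real.sSup_empty]
    exact one_pos
  · obtain ⟨z, hz, hz1, hmax⟩ := hne.csSup_mem (finite_setOf_norm_mem_spectrum W)
    obtain ⟨v, hv, hzv⟩ := mem_spectrum_iff_exists_mulVec_eq_smul.1 hz
    exact hmax ▸ hW.norm_lt_one hz1 hv hzv

end SpectralGap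

/-! ### The decentralization cost of a mixing network -/

section Cost

variable {m T : ℕ}

lemma card_filter_Icc_cast_lt_le {x : ℝ} (hx : 0 ≤ x) :
    (((Finset.Icc 1 T).filter fun t : ℕ => (t : ℝ) < x).card : ℝ) ≤ x := by
  have hsub : ((Finset.Icc 1 T).filter fun t : ℕ => (t : ℝ) < x) ⊆ Finset.Icc 1 ⌊x⌋₊ := by
    intro t ht
    rw [Finset.mem_filter, Finset.mem_Icc] at ht
    exact Finset.mem_Icc.2 ⟨ht.1.1, Nat.le_floor ht.2.le⟩
  refine le_trans ?_ (Nat.floor_le hx)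
  exact_mod_cast (Finset.card_le_card hsub).trans (by simp)

lemma sum_klVec_gibbs_le (θ : Fin m) {a b : ℕ → Fin m → ℝ} {d t₀ L : ℝ} (ht₀ : 0 ≤ t₀)
    (h : ∀ t k, |a t k - b t k| ≤ d)
    (ha : ∀ t ∈ Finset.Icc 1 T, t₀ ≤ t → ∀ k, k ≠ θ → a t k - a t θ ≤ -L)
    (hb : ∀ t ∈ Finset.Icc 1 T, t₀ ≤ t → ∀ k, k ≠ θ → b t k - b t θ ≤ -L)
    (hL : T * (m * Real.exp (-L)) ≤ 1) :
    ∑ t ∈ Finset.Icc 1 T, klVec (gibbs (a t)) (gibbs (b t)) ≤ 2 * d * t₀ + 4 * d := by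
  have : NeZero m := ⟨θ.pos.ne'⟩
  have hd : 0 ≤ d := (abs_nonneg _).trans (h 0 θ)
  have hterm (t) (ht : t ∈ Finset.Icc 1 T) : klVec (gibbs (a t)) (gibbs (b t)) ≤
      (if (t : ℝ) < t₀ then 2 * d else 0) + m * Real.exp (-L) * (4 * d) := by
    split_ifs with htt
    · exact (klVec_gibbs_le (h t)).trans (le_add_of_nonneg_right (by positivity))
    · rw [zero_add]
      exact klVec_gibbs_le_of_gap θ (h t) (ha t ht (not_lt.1 htt)) (hb t ht (not_lt.1 htt))
  calc ∑ t ∈ Finset.Icc 1 T, klVec (gibbs (a t)) (gibbs (b t))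
      ≤ ((Finset.Icc 1 T).filter fun t : ℕ => (t : ℝ) < t₀).card * (2 * d) +
          T * (m * Real.exp (-L)) * (4 * d) := by
        refine (Finset.sum_le_sum hterm).trans_eq ?_
        rw [Finset.sum_add_distrib, ← Finset.sum_filter]
        simp [mul_assoc]
    _ ≤ t₀ * (2 * d) + 1 * (4 * d) := by
        gcongr
        exact card_filter_Icc_cast_lt_le ht₀
    _ = 2 * d * t₀ + 4 * d := by ring

lemma IsSeparated.sum_klVec_gibbs_smul_le {θ : Fin m} {a b : ℕ → Fin m → ℝ} {t₁ ι D η Λ : ℝ}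
    (hsep : IsSeparated θ T t₁ ι b) (ht₁ : 0 ≤ t₁) (hι : 0 < ι) (hη : 0 < η) (hΛ : 0 ≤ Λ)
    (h : ∀ t k, |a t k - b t k| ≤ D) (hL : T * (m * Real.exp (-Λ)) ≤ 1) :
    ∑ t ∈ Finset.Icc 1 T, klVec (gibbs (η • a t)) (gibbs (η • b t)) ≤
      2 * (η * D) * (t₁ + 8 * D / ι + 4 * Λ / (η * ι)) + 4 * (η * D) := by
  have hD : 0 ≤ D := (abs_nonneg _).trans (h 0 θ)
  have hdev : 0 ≤ 8 * D / ι := by positivity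
  have hlog : 0 ≤ 4 * Λ / (η * ι) := by positivity
  have hscale {φ : Fin m → ℝ} {t : ℕ} {k : Fin m} (hφ : φ k - φ θ ≤ -(t * ι / 4))
      (ht : 4 * Λ / (η * ι) ≤ t) : (η • φ) k - (η • φ) θ ≤ -Λ := by
    rw [div_le_iff₀ (by positivity)] at ht
    have := mul_le_mul_of_nonneg_left hφ hη.le
    simp only [Pi.smul_apply, smul_eq_mul]
    linarith
  refine sum_klVec_gibbs_le θ (by positivity) (fun t k => ?_) (fun t ht htt k hk => ?_)
    (fun t ht htt k hk => ?_) hL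
  · simp only [Pi.smul_apply, smul_eq_mul]
    rw [← mul_sub, abs_mul, abs_of_pos hη]
    exact mul_le_mul_of_nonneg_left (h t k) hη.le
  · have hb := hsep t ht (by linarith) k hk
    have htD : 8 * D / ι ≤ t := by linarith
    rw [div_le_iff₀ hι] at htD
    have hk' := abs_le.1 (h t k)
    have hθ' := abs_le.1 (h t θ)
    exact hscale (φ := a t) (t := t) (by linarith) (by linarith)
  · have hb := hsep t ht (by linarith) k hk
    have : 0 ≤ (t : ℝ) * ι := by positivity
    exact hscale (φ := b t) (t := t) (by linarith) (by linarith)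

/-- The factor in front of `log (n m T) / γ` in the bound for the decentralization cost, for
networks whose summed distance to stationarity is at most `K / γ`, and at most `K` times the inverse
spectral gap. -/
noncomputable def costConst (B ι K : ℝ) : ℝ :=
  4 * B ^ 2 * K / ι ^ 2 + K ^ 2 * B / ι + 8 * B * K / ι + K / 4

lemma costConst_pos {B ι K : ℝ} (hB : 0 < B) (hι : 0 < ι) (hK : 0 < K) : 0 < costConst B ι K := by
  unfold costConst
  positivity

lemma cost_le_costConst {B ι K S g γ η Λ l : ℝ} (hB : 0 < B) (hι : 0 < ι) (hS : 0 ≤ S)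
    (hg : 0 < g) (hg1 : g ≤ 1) (hK : S * g ≤ K) (hγ : 0 < γ) (hKγ : S * γ ≤ K) (hΛ : 1 ≤ Λ)
    (hl : 1 ≤ l) (hη : η = g / (16 * B * l)) :
    2 * (η * (B * S)) * (32 * B ^ 2 * Λ / ι ^ 2 + 8 * (B * S) / ι + 4 * Λ / (η * ι)) +
      4 * (η * (B * S)) ≤ costConst B ι K * (Λ / γ) := by
  have hη0 : 0 < η := by rw [hη]; positivity
  have hηB : η * B ≤ g / 16 := by
    rw [hη, div_mul_eq_mul_div, div_le_div_iff₀ (by positivity) (by norm_num)]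
    nlinarith [mul_le_mul_of_nonneg_left hl (by positivity : 0 ≤ g * B)]
  have hSK : S ≤ K / γ := by rwa [le_div_iff₀ hγ]
  have hK0 : 0 ≤ K := (by positivity : 0 ≤ S * g).trans hK
  have hdK : η * (B * S) ≤ K / 16 := by nlinarith
  have hdγ : η * (B * S) ≤ K / γ / 16 := by nlinarith
  have hγΛ : 1 / γ ≤ Λ / γ := by gcongr
  have hseparation : 2 * (η * (B * S)) * (32 * B ^ 2 * Λ / ι ^ 2) ≤
      4 * B ^ 2 * K / ι ^ 2 * (Λ / γ) := by
    calc 2 * (η * (B * S)) * (32 * B ^ 2 * Λ / ι ^ 2)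
        ≤ 2 * (K / γ / 16) * (32 * B ^ 2 * Λ / ι ^ 2) := by gcongr
      _ = 4 * B ^ 2 * K / ι ^ 2 * (Λ / γ) := by field_simp; ring
  have hdeviation : 2 * (η * (B * S)) * (8 * (B * S) / ι) ≤ K ^ 2 * B / ι * (Λ / γ) := by
    calc 2 * (η * (B * S)) * (8 * (B * S) / ι)
        ≤ 2 * (K / 16) * (8 * (B * (K / γ)) / ι) := by gcongr
      _ = K ^ 2 * B / ι * (1 / γ) := by field_simp; ring
      _ ≤ K ^ 2 * B / ι * (Λ / γ) := by gcongr
  have hconcentration : 2 * (η * (B * S)) * (4 * Λ / (η * ι)) ≤ 8 * B * K / ι * (Λ / γ) := by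
    calc 2 * (η * (B * S)) * (4 * Λ / (η * ι)) = 8 * B * S * Λ / ι := by field_simp; ring
      _ ≤ 8 * B * (K / γ) * Λ / ι := by gcongr
      _ = 8 * B * K / ι * (Λ / γ) := by field_simp
  have htail : 4 * (η * (B * S)) ≤ K / 4 * (Λ / γ) := by
    calc 4 * (η * (B * S)) ≤ 4 * (K / γ / 16) := by gcongr
      _ = K / 4 * (1 / γ) := by ring
      _ ≤ K / 4 * (Λ / γ) := by gcongr
  unfold costConst
  linarith

lemma decentralizationCost_eq_of_isBelief {η : ℝ} (hη : 0 < η) [NeZero m]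
    {φ φ' μ μ' : ℕ → Fin m → ℝ} (h : ∀ t ∈ Finset.Icc 1 T, IsBelief η (φ t) (μ t))
    (h' : ∀ t ∈ Finset.Icc 1 T, IsBelief η (φ' t) (μ' t)) :
    decentralizationCost T μ μ' =
      ∑ t ∈ Finset.Icc 1 T, klVec (gibbs (η • φ t)) (gibbs (η • φ' t)) :=
  Finset.sum_congr rfl fun t ht => by rw [(h t ht).eq_gibbs hη, (h' t ht).eq_gibbs hη]

lemma ofReal_one_sub_le_measure_of_compl_subset {Ω : Type v} [MeasurableSpace Ω] {P : Measure Ω}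
    [IsProbabilityMeasure P] {A A' : Set Ω} {δ : ℝ} (hδ : 0 ≤ δ) (hA : P A ≤ ENNReal.ofReal δ)
    (h : Aᶜ ⊆ A') : ENNReal.ofReal (1 - δ) ≤ P A' := by
  rw [ENNReal.ofReal_sub _ hδ, ENNReal.ofReal_one, tsub_le_iff_right]
  calc (1 : ENNReal) = P (Aᶜ ∪ A) := by rw [Set.compl_union_self, measure_univ]
    _ ≤ P Aᶜ + P A := measure_union_le _ _
    _ ≤ P A' + ENNReal.ofReal δ := add_le_add (measure_mono h) hA

theorem costBound_of_mixesWithin {V : Type} [Fintype V] [DecidableEq V] {W : Matrix V V ℝ}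
    {ρ : V → ℝ} {S γ K B ι δ : ℝ} (hB : 0 < B) (hι : 0 < ι) (hδ : 0 < δ)
    (hW : MixesWithin W ρ S) (hK : S * spectralGap W ≤ K) (hγ : 0 < γ) (hKγ : S * γ ≤ K)
    (hcard : 3 ≤ Fintype.card V) (hδV : 1 / δ ≤ Fintype.card V) :
    CostBound.{u, v} W B ι δ fun m T =>
      costConst B ι K * (Real.log (Fintype.card V * m * T) / γ) := by
  intro m T hm hT M θ hM _ π hπ hinfo Ω _ P _ s hs η hη i μA μC hA hC
  obtain rfl := hπ.eq_of_mixesWithin hW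
  have : NeZero m := ⟨by omega⟩
  have hn : (3 : ℝ) ≤ Fintype.card V := by exact_mod_cast hcard
  set n : ℝ := (Fintype.card V : ℝ)
  have hmT : 1 ≤ (m : ℝ) * T := by exact_mod_cast Nat.one_le_iff_ne_zero.2 (by positivity)
  set Λ := Real.log (n * m * T) with hΛ
  have hl : 1 ≤ Real.log n := by
    rw [Real.le_log_iff_exp_le (by linarith)]
    linarith [Real.exp_one_lt_d9]
  have hΛ1 : 1 ≤ Λ := hl.trans <| Real.log_le_log (by linarith) <| by
    rw [mul_assoc]
    exact le_mul_of_one_le_right (by linarith) hmT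
  have hexp : T * (m * Real.exp (-Λ)) = 1 / n := by
    rw [Real.exp_neg, hΛ, Real.exp_log (by positivity)]
    field_simp
  have hgap := hW.spectralGap_pos
  have hη0 : 0 < η := by rw [hη]; positivity
  refine ofReal_one_sub_le_measure_of_compl_subset hδ.le
    ((hs.measure_not_isSeparated_le hB hι hM hπ.nonneg hπ.sum_eq_one hinfo (Λ := Λ)).trans
      (ENNReal.ofReal_le_ofReal ?_)) fun ω hω => ?_
  · rw [mul_assoc, hexp]
    exact (one_div_le (by linarith) hδ).2 hδV
  · have hsep := not_not.1 hω
    rw [Set.mem_ofPred_eq, decentralizationCost_eq_of_isBelief hη0 (hA ω) (hC ω)]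
    refine (hsep.sum_klVec_gibbs_smul_le (by positivity) hι hη0 (by linarith)
      (fun t k => hW.abs_agentPhi_sub_centralPhi_le hB.le (fun t i k => (hM i k (s t i ω)).2) t i k)
      ?_).trans
      (cost_le_costConst hB hι (by simpa using hW i 0) hgap (spectralGap_le_one W) hK hγ hKγ hΛ1
        hl hη)
    rw [hexp]
    exact (div_le_one (by linarith)).2 (by linarith)

end Cost

/-! ### Eigenfunctions and resolutions of the identity -/

section Eigenfunctions

variable {V : Type} [Fintype V] {W : Matrix V V ℝ} {l : ℝ}

/-- `f`, with values in a real vector space, is a right eigenvector of `W` for the real eigenvalue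
`l`; it is allowed to vanish. -/
def IsEigenfunction {E : Type*} [AddCommGroup E] [Module ℝ E] (W : Matrix V V ℝ) (l : ℝ)
    (f : V → E) : Prop :=
  ∀ i, ∑ j, W i j • f j = l • f i

namespace IsEigenfunction

section Module

variable {E F : Type*} [AddCommGroup E] [Module ℝ E] [AddCommGroup F] [Module ℝ F] {f : V → E}

lemma map (hf : IsEigenfunction W l f) (g : E →ₗ[ℝ] F) : IsEigenfunction W l fun i => g (f i) :=
  fun i => by simp only [← map_smul, ← map_sum, hf i]

lemma const (hrow : ∀ i, ∑ j, W i j = 1) (c : E) : IsEigenfunction W 1 fun _ => c :=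
  fun i => by rw [← Finset.sum_smul, hrow]

lemma pow [DecidableEq V] (hf : IsEigenfunction W l f) (s : ℕ) :
    IsEigenfunction (W ^ s) (l ^ s) f := by
  induction s with
  | zero => intro i; simp [Matrix.one_apply, ite_smul]
  | succ s ih =>
    intro i
    simp only [pow_succ, Matrix.mul_apply, Finset.sum_smul, mul_smul]
    rw [Finset.sum_comm]
    simp only [← Finset.smul_sum, hf _, smul_comm _ l, ih i]

end Module

lemma spectralGap_le [DecidableEq V] {f : V → ℂ} (hf : IsEigenfunction W l f) (hf0 : f ≠ 0)
    (hl : l ≠ 1) : spectralGap W ≤ 1 - |l| := by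
  rw [← Real.norm_eq_abs, ← Complex.norm_real]
  refine spectralGap_le_of_mulVec_eq_smul (by exact_mod_cast hl) hf0 (funext fun i => ?_)
  simpa only [Matrix.mulVec, dotProduct, Matrix.map_apply, Pi.smul_apply, smul_eq_mul,
    Complex.real_smul] using hf i

end IsEigenfunction

variable [DecidableEq V] {𝕜 : Type*} [RCLike 𝕜] {κ : Type*} {I : Finset κ} {ρ : V → ℝ}
  {E : κ → V → V → 𝕜} {l : κ → ℝ}

lemma pow_apply_of_resolution (hrow : ∀ i, ∑ j, W i j = 1)
    (hE : ∀ a ∈ I, ∀ j, IsEigenfunction W (l a) fun i => E a i j)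
    (hone : ∀ i j, (ρ j : 𝕜) + ∑ a ∈ I, E a i j = if i = j then 1 else 0) (s : ℕ) (i j : V) :
    ((W ^ s) i j : 𝕜) = ρ j + ∑ a ∈ I, l a ^ s • E a i j := by
  have hconst : ∑ r, (W ^ s) i r • (ρ j : 𝕜) = ρ j := by
    simpa using (IsEigenfunction.const hrow (ρ j : 𝕜)).pow s i
  calc ((W ^ s) i j : 𝕜) = ∑ r, (W ^ s) i r • ((ρ j : 𝕜) + ∑ a ∈ I, E a r j) := by
        simp [hone, RCLike.real_smul_eq_coe_mul]
    _ = ρ j + ∑ a ∈ I, ∑ r, (W ^ s) i r • E a r j := by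
        simp only [smul_add, Finset.sum_add_distrib, hconst, Finset.smul_sum]
        rw [Finset.sum_comm]
    _ = ρ j + ∑ a ∈ I, l a ^ s • E a i j := by
        congr 1
        exact Finset.sum_congr rfl fun a ha => (hE a ha j).pow s i

lemma mixesWithin_of_resolution {c : κ → ℝ} (hrow : ∀ i, ∑ j, W i j = 1)
    (hE : ∀ a ∈ I, ∀ j, IsEigenfunction W (l a) fun i => E a i j)
    (hone : ∀ i j, (ρ j : 𝕜) + ∑ a ∈ I, E a i j = if i = j then 1 else 0)
    (hl : ∀ a ∈ I, |l a| < 1) (hc : ∀ a ∈ I, ∀ i, ∑ j, ‖E a i j‖ ≤ c a) :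
    MixesWithin W ρ (∑ a ∈ I, c a / (1 - |l a|)) := by
  intro i t
  have hpow (s : ℕ) : ∑ j, |(W ^ s) i j - ρ j| ≤ ∑ a ∈ I, |l a| ^ s * c a := by
    calc ∑ j, |(W ^ s) i j - ρ j| ≤ ∑ j, ∑ a ∈ I, |l a| ^ s * ‖E a i j‖ := by
          refine Finset.sum_le_sum fun j _ => ?_
          rw [← RCLike.norm_ofReal (K := 𝕜), RCLike.ofReal_sub,
            pow_apply_of_resolution hrow hE hone, add_sub_cancel_left]
          refine (norm_sum_le _ _).trans_eq (Finset.sum_congr rfl fun a _ => ?_)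
          rw [norm_smul, norm_pow, Real.norm_eq_abs]
      _ = ∑ a ∈ I, |l a| ^ s * ∑ j, ‖E a i j‖ := by
          rw [Finset.sum_comm]
          simp only [Finset.mul_sum]
      _ ≤ ∑ a ∈ I, |l a| ^ s * c a := Finset.sum_le_sum fun a ha =>
          mul_le_mul_of_nonneg_left (hc a ha i) (by positivity)
  calc ∑ s ∈ Finset.range t, ∑ j, |(W ^ s) i j - ρ j|
      ≤ ∑ s ∈ Finset.range t, ∑ a ∈ I, |l a| ^ s * c a := Finset.sum_le_sum fun s _ => hpow s
    _ = ∑ a ∈ I, (∑ s ∈ Finset.range t, |l a| ^ s) * c a := by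
        rw [Finset.sum_comm]
        simp only [Finset.sum_mul]
    _ ≤ ∑ a ∈ I, (1 - |l a|)⁻¹ * c a := by
        refine Finset.sum_le_sum fun a ha => mul_le_mul_of_nonneg_right ?_
          ((Finset.sum_nonneg fun j _ => norm_nonneg (E a i j)).trans (hc a ha i))
        rw [← tsum_geometric_of_lt_one (abs_nonneg _) (hl a ha)]
        exact (summable_geometric_of_lt_one (abs_nonneg _) (hl a ha)).sum_le_tsum _
          fun _ _ => by positivity
    _ = ∑ a ∈ I, c a / (1 - |l a|) := Finset.sum_congr rfl fun a _ => inv_mul_eq_div _ _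

end Eigenfunctions

section CommMatrix

variable {V : Type} [Fintype V] {G : SimpleGraph V} {ω : ℝ}

lemma sum_commMatrix_smul [DecidableRel G.Adj] {E : Type*} [AddCommGroup E] [Module ℝ E] (i : V)
    (f : V → E) :
    ∑ j, commMatrix G ω i j • f j =
      ω • f i + ((1 - ω) / G.degree i) • ∑ j ∈ G.neighborFinset i, f j := by
  classical
  have hentry (j : V) : commMatrix G ω i j • f j = (if j = i then ω • f i else 0) +
      if G.Adj i j then ((1 - ω) / G.degree i) • f j else 0 := by
    rcases eq_or_ne j i with rfl | hj
    · simp [commMatrix]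
    · simp only [commMatrix, Matrix.of_apply, if_neg hj, if_neg hj.symm, zero_add, ite_smul,
        zero_smul]
      congr!
  simp only [hentry, Finset.sum_add_distrib, Finset.sum_ite_eq', Finset.mem_univ, if_true,
    Finset.smul_sum, ← Finset.sum_filter, SimpleGraph.neighborFinset_eq_filter]

lemma sum_commMatrix [DecidableRel G.Adj] {i : V} (hi : 0 < G.degree i) :
    ∑ j, commMatrix G ω i j = 1 := by
  have := sum_commMatrix_smul (G := G) (ω := ω) i fun _ => (1 : ℝ)
  simp only [smul_eq_mul, mul_one, Finset.sum_const, SimpleGraph.card_neighborFinset_eq_degree,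
    nsmul_eq_mul] at this
  rw [this]
  field_simp
  ring

end CommMatrix

/-! ### The star -/

section Star

variable {V : Type} {c : V} {ω : ℝ}

/-- The eigenvector of a star that tells the center from the leaves. -/
def starSign [DecidableEq V] (c j : V) : ℝ := if j = c then 1 else -1

lemma starSign_of_ne [DecidableEq V] {j : V} (hj : j ≠ c) : starSign c j = -1 := if_neg hj

lemma abs_starSign [DecidableEq V] (j : V) : |starSign c j| = 1 := by
  unfold starSign
  split_ifs <;> simp

variable [Fintype V]

lemma card_sub_one_ne_zero [Nontrivial V] : ((Fintype.card V - 1 : ℕ) : ℝ) ≠ 0 :=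
  Nat.cast_ne_zero.2 (Nat.sub_pos_of_lt Fintype.one_lt_card).ne'

lemma neighborFinset_starGraph_center [DecidableEq V] :
    (SimpleGraph.starGraph c).neighborFinset c = Finset.univ.erase c := by
  ext j
  simp [eq_comm]

lemma neighborFinset_starGraph_of_ne_center [DecidableEq V] {i : V} (hi : i ≠ c) :
    (SimpleGraph.starGraph c).neighborFinset i = {c} := by
  ext j
  simp only [SimpleGraph.mem_neighborFinset, SimpleGraph.starGraph_adj, Finset.mem_singleton]
  grind

lemma isEigenfunction_star {E : Type*} [AddCommGroup E] [Module ℝ E] {f : V → E} {l : ℝ}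
    (hcenter : ω • f c + ((1 - ω) / (Fintype.card V - 1 : ℕ)) • (∑ j, f j - f c) = l • f c)
    (hleaf : ∀ i, i ≠ c → ω • f i + (1 - ω) • f c = l • f i) :
    IsEigenfunction (commMatrix (SimpleGraph.starGraph c) ω) l f := by
  classical
  intro i
  rw [sum_commMatrix_smul]
  rcases eq_or_ne i c with rfl | hi
  · rw [neighborFinset_starGraph_center, SimpleGraph.degree_starGraph_center,
      Finset.sum_erase_eq_sub (Finset.mem_univ i), hcenter]
  · rw [neighborFinset_starGraph_of_ne_center hi, SimpleGraph.degree_starGraph_of_ne_center hi,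
      Finset.sum_singleton, Nat.cast_one, div_one, hleaf i hi]

lemma isEigenfunction_star_of_sum_eq_zero {E : Type*} [AddCommGroup E] [Module ℝ E] {f : V → E}
    (hc : f c = 0) (hsum : ∑ j, f j = 0) :
    IsEigenfunction (commMatrix (SimpleGraph.starGraph c) ω) ω f :=
  isEigenfunction_star (by simp [hc, hsum]) (by simp [hc])

variable [DecidableEq V]

/-- The stationary distribution of a star with center `c`, which does not depend on the
self-reliance. -/
noncomputable def starCentrality (c j : V) : ℝ :=
  if j = c then 1 / 2 else 1 / (2 * (Fintype.card V - 1 : ℕ))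

/-- The projections onto the nontrivial eigenspaces of a star, those of the eigenvalues `2ω - 1`
(`false`) and `ω` (`true`). -/
noncomputable def starProj (c : V) : Bool → V → V → ℝ
  | false, i, j => starCentrality c j * starSign c j * starSign c i
  | true, i, j => (if i = j then 1 else 0) - starCentrality c j -
      starCentrality c j * starSign c j * starSign c i

/-- The nontrivial eigenvalues of a star with self-reliance `ω`. -/
def starEigenvalue (ω : ℝ) : Bool → ℝ
  | false => 2 * ω - 1
  | true => ω

lemma starCentrality_of_ne {j : V} (hj : j ≠ c) :
    starCentrality c j = 1 / (2 * (Fintype.card V - 1 : ℕ)) :=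
  if_neg hj

lemma starCentrality_nonneg (j : V) : 0 ≤ starCentrality c j := by
  unfold starCentrality
  split_ifs <;> positivity

lemma abs_starEigenvalue_lt_one (h0 : 0 < ω) (h1 : ω < 1) (a : Bool) :
    |starEigenvalue ω a| < 1 := by
  cases a <;> simp only [starEigenvalue, abs_lt] <;> constructor <;> linarith

lemma sum_erase_univ_eq {f : V → ℝ} {x : ℝ} (hf : ∀ j, j ≠ c → f j = x) :
    ∑ j ∈ Finset.univ.erase c, f j = (Fintype.card V - 1 : ℕ) * x := by
  rw [Finset.sum_congr rfl fun j hj => hf j (Finset.ne_of_mem_erase hj)]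
  simp

lemma sum_starSign : ∑ j, starSign c j = 1 - (Fintype.card V - 1 : ℕ) := by
  rw [← Finset.add_sum_erase _ _ (Finset.mem_univ c),
    sum_erase_univ_eq fun j => starSign_of_ne, starSign, if_pos rfl]
  ring

variable [Nontrivial V]

lemma degree_starGraph_pos (i : V) : 0 < (SimpleGraph.starGraph c).degree i := by
  rcases eq_or_ne i c with rfl | hi
  · rw [SimpleGraph.degree_starGraph_center]
    exact Nat.sub_pos_of_lt Fintype.one_lt_card
  · rw [SimpleGraph.degree_starGraph_of_ne_center hi]
    exact one_pos

lemma sum_starCentrality : ∑ j, starCentrality c j = 1 := by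
  have herase : ∑ j ∈ Finset.univ.erase c, starCentrality c j = 1 / 2 := by
    rw [sum_erase_univ_eq fun j => starCentrality_of_ne]
    have := card_sub_one_ne_zero (V := V)
    field_simp
  rw [← Finset.add_sum_erase _ _ (Finset.mem_univ c), herase, starCentrality, if_pos rfl]
  norm_num

lemma isEigenfunction_starSign :
    IsEigenfunction (commMatrix (SimpleGraph.starGraph c) ω) (2 * ω - 1) (starSign c) := by
  refine isEigenfunction_star ?_ fun i hi => ?_
  · rw [sum_starSign]
    simp only [starSign, if_true, smul_eq_mul]
    have := card_sub_one_ne_zero (V := V)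
    field_simp
    ring
  · simp only [starSign, hi, if_true, if_false, smul_eq_mul]
    ring

lemma isEigenfunction_starProj (a : Bool) (j : V) :
    IsEigenfunction (commMatrix (SimpleGraph.starGraph c) ω) (starEigenvalue ω a)
      fun i => starProj c a i j := by
  have hcard := card_sub_one_ne_zero (V := V)
  cases a
  · exact (isEigenfunction_starSign (c := c) (ω := ω)).map
      (LinearMap.mulLeft ℝ (starCentrality c j * starSign c j))
  · apply isEigenfunction_star_of_sum_eq_zero
    · rcases eq_or_ne j c with rfl | hj
      · norm_num [starProj, starCentrality, starSign]
      · simp [starProj, starCentrality, starSign, hj, hj.symm]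
    · have hV : (Fintype.card V : ℝ) = (Fintype.card V - 1 : ℕ) + 1 := by
        rw [Nat.cast_sub Fintype.card_pos, Nat.cast_one, sub_add_cancel]
      simp only [starProj, Finset.sum_sub_distrib, ← Finset.mul_sum, sum_starSign,
        Finset.sum_ite_eq', Finset.mem_univ, if_true, Finset.sum_const,
        Finset.card_univ, nsmul_eq_mul, hV]
      simp only [starCentrality, starSign]
      split_ifs <;> field_simp <;> ring

lemma sum_abs_starProj_le (a : Bool) (i : V) :
    ∑ j, ‖starProj c a i j‖ ≤ if a then 3 else 1 := by
  have habs (j : V) : |starCentrality c j * starSign c j * starSign c i| = starCentrality c j := by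
    rw [abs_mul, abs_mul, abs_starSign, abs_starSign, abs_of_nonneg (starCentrality_nonneg j),
      mul_one, mul_one]
  cases a
  · simp only [starProj, Real.norm_eq_abs, habs, sum_starCentrality]
    simp
  · have hterm (j : V) : |starProj c true i j| ≤
        (if i = j then 1 else 0) + starCentrality c j + starCentrality c j := by
      refine (abs_sub _ _).trans (add_le_add ((abs_sub _ _).trans (add_le_add ?_ ?_)) (habs j).le)
      · split_ifs <;> simp
      · exact (abs_of_nonneg (starCentrality_nonneg j)).le
    refine (Finset.sum_le_sum fun j _ => hterm j).trans_eq ?_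
    simp only [Finset.sum_add_distrib, sum_starCentrality, Finset.sum_ite_eq, Finset.mem_univ,
      if_true]
    norm_num

lemma mixesWithin_star (h0 : 0 < ω) (h1 : ω < 1) :
    MixesWithin (commMatrix (SimpleGraph.starGraph c) ω) (starCentrality c)
      (3 / (1 - ω) + 1 / (1 - |2 * ω - 1|)) := by
  have h := mixesWithin_of_resolution (ρ := starCentrality c) (E := starProj c)
    (I := Finset.univ) (c := fun a => if a then 3 else 1)
    (fun i => sum_commMatrix (degree_starGraph_pos i))
    (fun a _ j => isEigenfunction_starProj a j)
    (fun i j => by simp [starProj])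
    (fun a _ => abs_starEigenvalue_lt_one h0 h1 a) (fun a _ => sum_abs_starProj_le a)
  simpa [starEigenvalue, abs_of_pos h0] using h

lemma spectralGap_star_le (hV : 3 ≤ Fintype.card V) (h0 : 0 < ω) (h1 : ω < 1) :
    spectralGap (commMatrix (SimpleGraph.starGraph c) ω) ≤ min (1 - ω) (1 - |2 * ω - 1|) := by
  have hproj (a : Bool) {i j : V} (hne : starProj c a i j ≠ 0) :
      spectralGap (commMatrix (SimpleGraph.starGraph c) ω) ≤ 1 - |starEigenvalue ω a| :=
    ((isEigenfunction_starProj a j).map Complex.ofRealCLM.toLinearMap).spectralGap_le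
      (Function.ne_iff.2 ⟨i, by simpa using hne⟩)
      fun h => (abs_starEigenvalue_lt_one h0 h1 a).ne (by rw [h, abs_one])
  obtain ⟨i, hi⟩ := exists_ne c
  have hcard : (2 : ℝ) ≤ (Fintype.card V - 1 : ℕ) := by exact_mod_cast Nat.le_sub_one_of_lt hV
  have hω : starProj c true i i ≠ 0 := by
    simp only [starProj, starCentrality, starSign, hi, if_true, if_false]
    have : 1 / (2 * (Fintype.card V - 1 : ℕ)) ≤ (1 / 4 : ℝ) := by
      rw [div_le_div_iff₀ (by linarith) (by norm_num)]
      linarith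
    linarith
  have hsign : starProj c false c c ≠ 0 := by simp [starProj, starCentrality, starSign]
  exact le_min (by simpa [starEigenvalue, abs_of_pos h0] using hproj true hω) (hproj false hsign)

end Star

/-! ### The cycle -/

section TrigonometricBounds

open Real

lemma sum_one_div_sq_le {ι : Type*} {s : Finset ι} {g : ι → ℤ} (hg : Function.Injective g) :
    ∑ a ∈ s, 1 / (g a : ℝ) ^ 2 ≤ π ^ 2 / 3 := by
  have hsum : HasSum (fun q : ℤ => 1 / (q : ℝ) ^ 2)
      (π ^ 2 / 6 + π ^ 2 / 6 - 1 / ((0 : ℤ) : ℝ) ^ 2) :=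
    HasSum.of_nat_of_neg (by simpa using hasSum_zeta_two) (by simpa using hasSum_zeta_two)
  have h := sum_le_hasSum (s.map ⟨g, hg⟩) (fun _ _ => by positivity) hsum
  rw [Finset.sum_map] at h
  exact h.trans_eq (by norm_num; ring)

lemma one_div_sin_pi_mul_sq_le {x : ℝ} (hx0 : 0 < x) (hx1 : x < 1) :
    1 / sin (π * x) ^ 2 ≤ (1 / x ^ 2 + 1 / (1 - x) ^ 2) / 4 := by
  wlog h : x ≤ 1 / 2 generalizing x
  · have := this (x := 1 - x) (by linarith) (by linarith) (by linarith)
    rwa [mul_one_sub, sin_pi_sub, sub_sub_cancel, add_comm] at this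
  have hsin : 2 * x ≤ sin (π * x) := by
    have := mul_le_sin (x := π * x) (by positivity) (by nlinarith [pi_pos])
    rwa [← mul_assoc, div_mul_cancel₀ _ pi_ne_zero] at this
  calc 1 / sin (π * x) ^ 2 ≤ 1 / (2 * x) ^ 2 := by gcongr
    _ = 1 / x ^ 2 / 4 := by field_simp; norm_num
    _ ≤ (1 / x ^ 2 + 1 / (1 - x) ^ 2) / 4 := by
        gcongr
        exact le_add_of_nonneg_right (by positivity)

lemma one_sub_two_mul_sq_le_cos_pi_mul_sq {x : ℝ} (hx0 : 0 ≤ x) (hx1 : x ≤ 1) :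
    (1 - 2 * x) ^ 2 ≤ cos (π * x) ^ 2 := by
  wlog h : x ≤ 1 / 2 generalizing x
  · have := this (x := 1 - x) (by linarith) (by linarith) (by linarith)
    rw [mul_one_sub π, cos_pi_sub, neg_sq] at this
    linarith
  have hcos : 1 - 2 * x ≤ cos (π * x) := by
    have := one_sub_mul_le_cos (x := π * x) (by positivity) (by nlinarith [pi_pos])
    rwa [← mul_assoc, div_mul_cancel₀ _ pi_ne_zero] at this
  gcongr
  linarith

lemma one_div_one_sub_abs_le {l : ℝ} (hl : |l| < 1) :
    1 / (1 - |l|) ≤ 1 / (1 - l) + 1 / (1 + l) := by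
  obtain ⟨h0, h1⟩ := abs_lt.1 hl
  have hp : 0 < 1 / (1 - l) := one_div_pos.2 (by linarith)
  have hm : 0 < 1 / (1 + l) := one_div_pos.2 (by linarith)
  rcases abs_choice l with h | h <;> rw [h]
  · linarith
  · rw [sub_neg_eq_add]
    linarith

end TrigonometricBounds

section Cycle

variable {n : ℕ} {ω : ℝ}

lemma sum_neighborFinset_cycleGraph {E : Type*} [AddCommGroup E] (x : Fin (n + 3))
    (f : Fin (n + 3) → E) :
    ∑ y ∈ (SimpleGraph.cycleGraph (n + 3)).neighborFinset x, f y = f (x + 1) + f (x - 1) := by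
  have hne : x - 1 ≠ x + 1 := by
    simp only [ne_eq, sub_eq_iff_eq_add, add_assoc x, left_eq_add]
    exact ne_of_beq_false rfl
  rw [SimpleGraph.cycleGraph_neighborFinset, Finset.sum_pair hne, add_comm]

/-- The character `x ↦ exp (2 π i x / (n + 3))` of the vertices of a cycle, which are read as the
elements of `ZMod (n + 3)`. -/
noncomputable def cycleChar (x : Fin (n + 3)) : ℂ := ZMod.stdAddChar (N := n + 3) x

lemma cycleChar_zero : cycleChar (0 : Fin (n + 3)) = 1 :=
  AddChar.map_zero_eq_one (ZMod.stdAddChar (N := n + 3))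

lemma cycleChar_add (x y : Fin (n + 3)) : cycleChar (x + y) = cycleChar x * cycleChar y :=
  AddChar.map_add_eq_mul (ZMod.stdAddChar (N := n + 3)) x y

lemma norm_cycleChar (x : Fin (n + 3)) : ‖cycleChar x‖ = 1 :=
  AddChar.norm_apply (ZMod.stdAddChar (N := n + 3)) x

lemma sum_cycleChar_mul (x : Fin (n + 3)) :
    ∑ a, cycleChar (a * x) = if x = 0 then ((n + 3 : ℕ) : ℂ) else 0 := by
  refine (AddChar.sum_mulShift (R := ZMod (n + 3)) (R' := ℂ) x
    (ZMod.isPrimitive_stdAddChar (n + 3))).trans ?_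
  rw [ZMod.card, Nat.cast_ite, Nat.cast_zero]
  rfl

lemma cycleChar_add_cycleChar_neg (a : Fin (n + 3)) :
    cycleChar a + cycleChar (-a) = 2 * (Real.cos (2 * Real.pi * (a.val / (n + 3 : ℕ))) : ℝ) := by
  have hexp : cycleChar a =
      Complex.exp ((2 * Real.pi * (a.val / (n + 3 : ℕ)) : ℝ) * Complex.I) := by
    have h := congrArg (fun z : Circle => (z : ℂ)) (ZMod.toCircle_eq_circleExp (N := n + 3) a)
    simp only [Circle.coe_exp] at h
    exact h
  have hneg : cycleChar (-a) = (cycleChar a)⁻¹ :=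
    AddChar.map_neg_eq_inv (ZMod.stdAddChar (N := n + 3)) a
  rw [hneg, hexp, ← Complex.exp_neg, Complex.ofReal_cos, Complex.two_cos, neg_mul]

/-- The eigenvalue of a cycle of length `n + 3` with self-reliance `ω` at the frequency `a`. -/
noncomputable def cycleEigenvalue (ω : ℝ) (a : Fin (n + 3)) : ℝ :=
  ω + (1 - ω) * Real.cos (2 * Real.pi * (a.val / (n + 3 : ℕ)))

open scoped Fin.CommRing in
lemma isEigenfunction_cycleChar (ω : ℝ) (a y : Fin (n + 3)) :
    IsEigenfunction (commMatrix (SimpleGraph.cycleGraph (n + 3)) ω) (cycleEigenvalue ω a)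
      fun x => cycleChar (a * (x - y)) := by
  intro x
  have hsucc : a * (x + 1 - y) = a * (x - y) + a := by ring
  have hpred : a * (x - 1 - y) = a * (x - y) + -a := by ring
  rw [sum_commMatrix_smul, sum_neighborFinset_cycleGraph, SimpleGraph.cycleGraph_degree_three_le,
    hsucc, hpred, cycleChar_add, cycleChar_add, ← mul_add,
    cycleChar_add_cycleChar_neg, cycleEigenvalue]
  simp only [Complex.real_smul]
  push_cast
  ring

lemma one_sub_cycleEigenvalue (ω : ℝ) (a : Fin (n + 3)) : 1 - cycleEigenvalue ω a =
    2 * (1 - ω) * Real.sin (Real.pi * (a.val / (n + 3 : ℕ))) ^ 2 := by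
  rw [cycleEigenvalue, mul_assoc, Real.cos_two_mul, Real.sin_sq]
  ring

lemma one_add_cycleEigenvalue (ω : ℝ) (a : Fin (n + 3)) : 1 + cycleEigenvalue ω a =
    2 * ω + 2 * (1 - ω) * Real.cos (Real.pi * (a.val / (n + 3 : ℕ))) ^ 2 := by
  rw [cycleEigenvalue, mul_assoc, Real.cos_two_mul]
  ring

lemma frequency_pos {a : Fin (n + 3)} (ha : a ≠ 0) : 0 < (a.val : ℝ) / (n + 3 : ℕ) := by
  have := Fin.val_pos_iff.2 (Fin.pos_iff_ne_zero.2 ha)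
  positivity

lemma frequency_lt_one (a : Fin (n + 3)) : (a.val : ℝ) / (n + 3 : ℕ) < 1 :=
  (div_lt_one (by positivity)).2 (Nat.cast_lt.2 a.isLt)

lemma abs_cycleEigenvalue_lt_one (h0 : 0 < ω) (h1 : ω < 1) {a : Fin (n + 3)} (ha : a ≠ 0) :
    |cycleEigenvalue ω a| < 1 := by
  have := sub_pos.2 h1
  have hsin : 0 < Real.sin (Real.pi * (a.val / (n + 3 : ℕ))) :=
    Real.sin_pos_of_pos_of_lt_pi (mul_pos Real.pi_pos (frequency_pos ha))
      (mul_lt_of_lt_one_right Real.pi_pos (frequency_lt_one a))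
  have hsub : 0 < 1 - cycleEigenvalue ω a := by
    rw [one_sub_cycleEigenvalue]
    positivity
  have hadd : 0 < 1 + cycleEigenvalue ω a := by
    rw [one_add_cycleEigenvalue]
    positivity
  exact abs_lt.2 ⟨by linarith, by linarith⟩

lemma one_div_one_sub_cycleEigenvalue_le (h1 : ω < 1) {a : Fin (n + 3)} (ha : a ≠ 0) :
    1 / (1 - cycleEigenvalue ω a) ≤ ((n + 3 : ℕ) : ℝ) ^ 2 / (8 * (1 - ω)) *
      (1 / ((a.val : ℤ) : ℝ) ^ 2 + 1 / ((n + 3 : ℕ) - a.val : ℤ) ^ 2) := by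
  have hω : 0 < 1 - ω := sub_pos.2 h1
  have hx0 := frequency_pos ha
  have hx1 := frequency_lt_one a
  have hN : (0 : ℝ) < (n + 3 : ℕ) := by positivity
  rw [one_sub_cycleEigenvalue, Int.cast_sub, Int.cast_natCast, Int.cast_natCast]
  set N : ℝ := ((n + 3 : ℕ) : ℝ)
  calc 1 / (2 * (1 - ω) * Real.sin (Real.pi * (a.val / N)) ^ 2)
      = 1 / (2 * (1 - ω)) * (1 / Real.sin (Real.pi * (a.val / N)) ^ 2) := by
        rw [one_div_mul_one_div]
    _ ≤ 1 / (2 * (1 - ω)) * ((1 / (a.val / N) ^ 2 + 1 / (1 - a.val / N) ^ 2) / 4) :=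
        mul_le_mul_of_nonneg_left (one_div_sin_pi_mul_sq_le hx0 hx1) (by positivity)
    _ = N ^ 2 / (8 * (1 - ω)) * (1 / a.val ^ 2 + 1 / (N - a.val) ^ 2) := by
        rw [one_sub_div hN.ne', div_pow, div_pow, one_div_div, one_div_div]
        field_simp
        ring

lemma one_div_one_add_cycleEigenvalue_le (h0 : 0 < ω) (h1 : ω < 1) (a : Fin (n + 3)) :
    1 / (1 + cycleEigenvalue ω a) ≤
      ((n + 3 : ℕ) : ℝ) ^ 2 / (2 * (1 - ω)) * (1 / ((n + 3 : ℕ) - 2 * a.val : ℤ) ^ 2) +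
        if 2 * a.val = n + 3 then 1 / (2 * ω) else 0 := by
  have hω : 0 < 1 - ω := sub_pos.2 h1
  have hN : (0 : ℝ) < (n + 3 : ℕ) := by positivity
  have hcos := one_sub_two_mul_sq_le_cos_pi_mul_sq (x := a.val / (n + 3 : ℕ)) (by positivity)
    (frequency_lt_one a).le
  rw [one_add_cycleEigenvalue]
  split_ifs with h
  · have h2 : 0 ≤ 2 * (1 - ω) * Real.cos (Real.pi * (a.val / (n + 3 : ℕ))) ^ 2 := by positivity
    refine (one_div_le_one_div_of_le (by positivity) (le_add_of_nonneg_right h2)).trans ?_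
    exact le_add_of_nonneg_left (by positivity)
  · have hne : ((n + 3 : ℕ) : ℝ) - 2 * a.val ≠ 0 := fun h' =>
      h (by exact_mod_cast (sub_eq_zero.1 h').symm)
    rw [add_zero, Int.cast_sub, Int.cast_mul, Int.cast_natCast, Int.cast_natCast, Int.cast_ofNat]
    set N : ℝ := ((n + 3 : ℕ) : ℝ)
    have hfreq : (N - 2 * a.val) / N = 1 - 2 * (a.val / N) := by field_simp
    calc 1 / (2 * ω + 2 * (1 - ω) * Real.cos (Real.pi * (a.val / N)) ^ 2)
        ≤ 1 / (2 * (1 - ω) * ((N - 2 * a.val) / N) ^ 2) := by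
          refine one_div_le_one_div_of_le (by positivity) ?_
          rw [hfreq]
          linarith [mul_le_mul_of_nonneg_left hcos (by positivity : 0 ≤ 2 * (1 - ω))]
      _ = N ^ 2 / (2 * (1 - ω)) * (1 / (N - 2 * a.val) ^ 2) := by
          rw [div_pow]
          field_simp

/-- An upper bound for the sum of `1 / (1 - |l|)` over the nontrivial eigenvalues `l` of a cycle of
length `N` with self-reliance `ω`. The second summand is the contribution of the eigenvalue
`2ω - 1`, which occurs for even `N` only and may be close to `-1`. -/
noncomputable def cycleMixingSum (N : ℕ) (ω : ℝ) : ℝ :=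
  Real.pi ^ 2 * N ^ 2 / (4 * (1 - ω)) + if Even N then 1 / (2 * ω) else 0

lemma sum_ite_two_mul_val_eq_le (N : ℕ) (s : Finset (Fin N)) {x : ℝ} (hx : 0 ≤ x) :
    ∑ a ∈ s, (if 2 * a.val = N then x else 0) ≤ if Even N then x else 0 := by
  rw [← Finset.sum_filter, Finset.sum_const, nsmul_eq_mul]
  split_ifs with h
  · refine mul_le_of_le_one_left hx (Nat.cast_le_one.2 (Finset.card_le_one.2 ?_))
    grind
  · rw [Finset.filter_false_of_mem fun a _ ha => h ⟨a.val, by omega⟩]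
    simp

lemma sum_one_div_one_sub_abs_cycleEigenvalue_le (h0 : 0 < ω) (h1 : ω < 1) :
    ∑ a ∈ Finset.univ.erase (0 : Fin (n + 3)), 1 / (1 - |cycleEigenvalue ω a|) ≤
      cycleMixingSum (n + 3) ω := by
  have hω : 0 < 1 - ω := sub_pos.2 h1
  have hsum_val := sum_one_div_sq_le (s := Finset.univ.erase (0 : Fin (n + 3)))
    (g := fun a => (a.val : ℤ)) fun a b h => by grind
  have hsum_sub := sum_one_div_sq_le (s := Finset.univ.erase (0 : Fin (n + 3)))
    (g := fun a => (n + 3 : ℕ) - a.val) fun a b h => by grind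
  have hsum_two := sum_one_div_sq_le (s := Finset.univ.erase (0 : Fin (n + 3)))
    (g := fun a => (n + 3 : ℕ) - 2 * a.val) fun a b h => by grind
  have hsum_mid := sum_ite_two_mul_val_eq_le (n + 3) (Finset.univ.erase 0)
    (by positivity : 0 ≤ 1 / (2 * ω))
  refine (Finset.sum_le_sum fun a ha =>
    (one_div_one_sub_abs_le (abs_cycleEigenvalue_lt_one h0 h1 (Finset.ne_of_mem_erase ha))).trans
      (add_le_add (one_div_one_sub_cycleEigenvalue_le h1 (Finset.ne_of_mem_erase ha))
        (one_div_one_add_cycleEigenvalue_le h0 h1 a))).trans ?_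
  simp only [Finset.sum_add_distrib, ← Finset.mul_sum]
  set N : ℝ := ((n + 3 : ℕ) : ℝ) with hN
  calc _ ≤ N ^ 2 / (8 * (1 - ω)) * (Real.pi ^ 2 / 3 + Real.pi ^ 2 / 3) +
        (N ^ 2 / (2 * (1 - ω)) * (Real.pi ^ 2 / 3) +
          if Even (n + 3) then 1 / (2 * ω) else 0) := by
        gcongr
    _ = cycleMixingSum (n + 3) ω := by
        rw [cycleMixingSum, ← hN, ← add_assoc]
        congr 1
        field_simp
        ring

lemma cycle_resolution (x y : Fin (n + 3)) :
    ((1 / (n + 3 : ℕ) : ℝ) : ℂ) + ∑ a ∈ Finset.univ.erase (0 : Fin (n + 3)),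
      1 / ((n + 3 : ℕ) : ℂ) * cycleChar (a * (x - y)) = if x = y then 1 else 0 := by
  have hN : ((n + 3 : ℕ) : ℂ) ≠ 0 := by exact_mod_cast (by omega : n + 3 ≠ 0)
  have hsum := sum_cycleChar_mul (x - y)
  rw [← Finset.add_sum_erase _ _ (Finset.mem_univ 0), zero_mul, cycleChar_zero] at hsum
  rw [← Finset.mul_sum, Complex.ofReal_div, Complex.ofReal_one, Complex.ofReal_natCast,
    ← mul_one_add, hsum]
  simp only [sub_eq_zero, mul_ite, one_div_mul_cancel hN, mul_zero]

lemma sum_commMatrix_cycle (ω : ℝ) (x : Fin (n + 3)) :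
    ∑ y, commMatrix (SimpleGraph.cycleGraph (n + 3)) ω x y = 1 :=
  sum_commMatrix (by rw [SimpleGraph.cycleGraph_degree_three_le]; exact two_pos)

lemma mixesWithin_cycle (h0 : 0 < ω) (h1 : ω < 1) :
    MixesWithin (commMatrix (SimpleGraph.cycleGraph (n + 3)) ω) (fun _ => 1 / ((n + 3 : ℕ) : ℝ))
      (cycleMixingSum (n + 3) ω) := by
  have hnorm (a x : Fin (n + 3)) :
      ∑ y, ‖1 / ((n + 3 : ℕ) : ℂ) * cycleChar (a * (x - y))‖ ≤ 1 := by
    simp only [norm_mul, norm_cycleChar, mul_one, norm_div, norm_one, Complex.norm_natCast,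
      Finset.sum_const, Finset.card_univ, Fintype.card_fin, nsmul_eq_mul]
    exact (mul_one_div_cancel (by positivity)).le
  exact (mixesWithin_of_resolution (I := Finset.univ.erase (0 : Fin (n + 3))) (c := fun _ => 1)
    (sum_commMatrix_cycle ω)
    (fun a _ y => (isEigenfunction_cycleChar ω a y).map (LinearMap.mulLeft ℝ _)) cycle_resolution
    (fun a ha => abs_cycleEigenvalue_lt_one h0 h1 (Finset.ne_of_mem_erase ha))
    fun a _ x => hnorm a x).mono (sum_one_div_one_sub_abs_cycleEigenvalue_le h0 h1)

lemma cycleMixingSum_mul_le {g : ℝ} (h0 : 0 < ω) (h1 : ω < 1)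
    (hsin : g ≤ 2 * (1 - ω) * Real.sin (Real.pi / (n + 3 : ℕ)) ^ 2)
    (heven : Even (n + 3) → g ≤ 2 * ω) : cycleMixingSum (n + 3) ω * g ≤ 50 := by
  have hω : 0 < 1 - ω := sub_pos.2 h1
  have hN : (0 : ℝ) < (n + 3 : ℕ) := by positivity
  have hite : (if Even (n + 3) then 1 / (2 * ω) else 0) * g ≤ 1 := by
    split_ifs with h
    · rw [one_div, inv_mul_le_iff₀ (by positivity), mul_one]
      exact heven h
    · simp
  rw [cycleMixingSum, add_mul]
  set N : ℝ := ((n + 3 : ℕ) : ℝ)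
  have hs : Real.sin (Real.pi / N) ^ 2 ≤ (Real.pi / N) ^ 2 := by
    rw [sq_le_sq]
    exact Real.abs_sin_le_abs
  have hmain : Real.pi ^ 2 * N ^ 2 / (4 * (1 - ω)) * g ≤ 49 := by
    calc Real.pi ^ 2 * N ^ 2 / (4 * (1 - ω)) * g
        ≤ Real.pi ^ 2 * N ^ 2 / (4 * (1 - ω)) * (2 * (1 - ω) * (Real.pi / N) ^ 2) := by
          gcongr
          exact hsin.trans (by gcongr)
      _ = (Real.pi ^ 2) ^ 2 / 2 := by field_simp; norm_num
      _ ≤ 9.89 ^ 2 / 2 := by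
          gcongr
          nlinarith [Real.pi_lt_d4, Real.pi_pos]
      _ ≤ 49 := by norm_num
  linarith

lemma exists_cycleEigenvalue_eq (ω : ℝ) (h : Even (n + 3)) :
    ∃ a : Fin (n + 3), cycleEigenvalue ω a = 2 * ω - 1 := by
  obtain ⟨q, hq⟩ := h
  refine ⟨⟨q, by omega⟩, ?_⟩
  have hq0 : (q : ℝ) ≠ 0 := by exact_mod_cast (by omega : q ≠ 0)
  have hangle : 2 * Real.pi * ((q : ℝ) / (n + 3 : ℕ)) = Real.pi := by
    rw [hq, Nat.cast_add]
    field_simp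
    norm_num
  rw [cycleEigenvalue, hangle, Real.cos_pi]
  ring

lemma cycleChar_mul_sub_zero_ne_zero (a : Fin (n + 3)) : (fun x => cycleChar (a * (x - 0))) ≠ 0 :=
  Function.ne_iff.2 ⟨0, norm_ne_zero_iff.1 (by rw [norm_cycleChar]; exact one_ne_zero)⟩

lemma spectralGap_cycle_le (h0 : 0 < ω) (h1 : ω < 1) :
    spectralGap (commMatrix (SimpleGraph.cycleGraph (n + 3)) ω) ≤
      2 * (1 - ω) * Real.sin (Real.pi / (n + 3 : ℕ)) ^ 2 := by
  have hlt := abs_cycleEigenvalue_lt_one h0 h1 (one_ne_zero : (1 : Fin (n + 3)) ≠ 0)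
  have hgap := (isEigenfunction_cycleChar ω (1 : Fin (n + 3)) 0).spectralGap_le
    (cycleChar_mul_sub_zero_ne_zero 1) ((le_abs_self _).trans_lt hlt).ne
  have hl := one_sub_cycleEigenvalue ω (1 : Fin (n + 3))
  rw [Fin.val_one, Nat.cast_one, mul_one_div] at hl
  rw [← hl]
  exact hgap.trans (sub_le_sub_left (le_abs_self _) 1)

lemma spectralGap_cycle_le_of_even (h1 : ω < 1) (he : Even (n + 3)) :
    spectralGap (commMatrix (SimpleGraph.cycleGraph (n + 3)) ω) ≤ 2 * ω := by
  obtain ⟨a, ha⟩ := exists_cycleEigenvalue_eq ω he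
  have hgap := (isEigenfunction_cycleChar ω a 0).spectralGap_le
    (cycleChar_mul_sub_zero_ne_zero a) (by rw [ha]; linarith)
  rw [ha] at hgap
  linarith [neg_abs_le (2 * ω - 1)]

end Cycle

/-! ### Averages of two independent walks -/

/-- The probability that `s` fair coin tosses show `r` heads. -/
noncomputable def binomialWeight (s r : ℕ) : ℝ := (1 / 2) ^ s * s.choose r

lemma binomialWeight_nonneg (s r : ℕ) : 0 ≤ binomialWeight s r := by
  unfold binomialWeight
  positivity

lemma binomialWeight_symm {s r : ℕ} (h : r ≤ s) :
    binomialWeight s (s - r) = binomialWeight s r := by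
  rw [binomialWeight, Nat.choose_symm h, binomialWeight]

lemma sum_binomialWeight (s : ℕ) : ∑ r ∈ Finset.range (s + 1), binomialWeight s r = 1 := by
  simp only [binomialWeight, ← Finset.mul_sum]
  rw [← Nat.cast_sum, Nat.sum_range_choose, Nat.cast_pow, ← mul_pow]
  norm_num

lemma binomialWeight_succ_succ (s r : ℕ) :
    binomialWeight (s + 1) (r + 1) =
      1 / 2 * binomialWeight s r + 1 / 2 * binomialWeight s (r + 1) := by
  simp only [binomialWeight, Nat.choose_succ_succ]
  push_cast
  ring

/-- Each head is awaited for two tosses on average. -/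
lemma sum_binomialWeight_left_le (r t : ℕ) : ∑ s ∈ Finset.range t, binomialWeight s r ≤ 2 := by
  induction r generalizing t with
  | zero => simpa only [binomialWeight, Nat.choose_zero_right, Nat.cast_one, mul_one] using
      sum_geometric_two_le t
  | succ r ihr =>
    induction t with
    | zero => simp
    | succ t iht =>
      rw [Finset.sum_range_succ', binomialWeight, Nat.choose_zero_succ]
      simp only [binomialWeight_succ_succ, Finset.sum_add_distrib, ← Finset.mul_sum]
      linarith [ihr t]

lemma sum_sum_binomialWeight_mul_le {d : ℕ → ℝ} {S : ℝ} (hd : ∀ r, 0 ≤ d r)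
    (hS : ∀ t, ∑ r ∈ Finset.range t, d r ≤ S) (t : ℕ) :
    ∑ s ∈ Finset.range t, ∑ r ∈ Finset.range (s + 1), binomialWeight s r * d r ≤ 2 * S := by
  calc ∑ s ∈ Finset.range t, ∑ r ∈ Finset.range (s + 1), binomialWeight s r * d r
      ≤ ∑ s ∈ Finset.range t, ∑ r ∈ Finset.range t, binomialWeight s r * d r :=
        Finset.sum_le_sum fun s hs => Finset.sum_le_sum_of_subset_of_nonneg
          (Finset.range_subset_range.2 (Finset.mem_range.1 hs))
          fun r _ _ => mul_nonneg (binomialWeight_nonneg s r) (hd r)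
    _ = ∑ r ∈ Finset.range t, (∑ s ∈ Finset.range t, binomialWeight s r) * d r := by
        rw [Finset.sum_comm]
        simp only [Finset.sum_mul]
    _ ≤ ∑ r ∈ Finset.range t, 2 * d r := Finset.sum_le_sum fun r _ =>
        mul_le_mul_of_nonneg_right (sum_binomialWeight_left_le r t) (hd r)
    _ ≤ 2 * S := by
        rw [← Finset.mul_sum]
        exact mul_le_mul_of_nonneg_left (hS t) two_pos.le

section Product

open scoped Kronecker

lemma kronecker_pow {R n n' : Type*} [CommSemiring R] [Fintype n] [Fintype n'] [DecidableEq n]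
    [DecidableEq n'] (A : Matrix n n R) (B : Matrix n' n' R) (s : ℕ) :
    (A ⊗ₖ B) ^ s = (A ^ s) ⊗ₖ (B ^ s) := by
  induction s with
  | zero => simp only [pow_zero, Matrix.one_kronecker_one]
  | succ s ih => rw [pow_succ, ih, ← Matrix.mul_kronecker_mul, pow_succ, pow_succ]

lemma sum_abs_mul_sub_mul_le {V V' : Type*} [Fintype V] [Fintype V'] {p ρ : V → ℝ}
    {q ρ' : V' → ℝ} (hρ : ρ ∈ stdSimplex ℝ V) (hq : q ∈ stdSimplex ℝ V') :
    ∑ y : V × V', |p y.1 * q y.2 - ρ y.1 * ρ' y.2| ≤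
      ∑ j, |p j - ρ j| + ∑ j, |q j - ρ' j| := by
  calc ∑ y : V × V', |p y.1 * q y.2 - ρ y.1 * ρ' y.2|
      ≤ ∑ y : V × V', (|p y.1 - ρ y.1| * q y.2 + ρ y.1 * |q y.2 - ρ' y.2|) := by
        refine Finset.sum_le_sum fun y _ => ?_
        calc |p y.1 * q y.2 - ρ y.1 * ρ' y.2|
            = |(p y.1 - ρ y.1) * q y.2 + ρ y.1 * (q y.2 - ρ' y.2)| := by ring_nf
          _ ≤ |p y.1 - ρ y.1| * q y.2 + ρ y.1 * |q y.2 - ρ' y.2| := by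
            refine (abs_add_le _ _).trans_eq ?_
            rw [abs_mul, abs_mul, abs_of_nonneg (hq.1 _), abs_of_nonneg (hρ.1 _)]
    _ = ∑ j, |p j - ρ j| + ∑ j, |q j - ρ' j| := by
        simp only [Fintype.sum_prod_type, Finset.sum_add_distrib, ← Finset.mul_sum,
          ← Finset.sum_mul, hq.2, hρ.2, mul_one, one_mul]

variable {V V' : Type} [DecidableEq V] [DecidableEq V']

/-- The walk that moves by `U` in the first or by `U'` in the second coordinate, according to the
toss of a fair coin. -/
noncomputable def productWalk (U : Matrix V V ℝ) (U' : Matrix V' V' ℝ) :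
    Matrix (V × V') (V × V') ℝ :=
  (1 / 2 : ℝ) • (U ⊗ₖ (1 : Matrix V' V' ℝ) + (1 : Matrix V V ℝ) ⊗ₖ U')

variable {U : Matrix V V ℝ} {U' : Matrix V' V' ℝ}

lemma productWalk_apply (x y : V × V') :
    productWalk U U' x y = 1 / 2 * (U x.1 y.1 * (if x.2 = y.2 then 1 else 0) +
      (if x.1 = y.1 then 1 else 0) * U' x.2 y.2) :=
  rfl

variable [Fintype V] [Fintype V']

lemma productWalk_pow_apply (s : ℕ) (x y : V × V') :
    (productWalk U U' ^ s) x y = ∑ r ∈ Finset.range (s + 1),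
      binomialWeight s r * ((U ^ r) x.1 y.1 * (U' ^ (s - r)) x.2 y.2) := by
  have hcomm : Commute (U ⊗ₖ (1 : Matrix V' V' ℝ)) ((1 : Matrix V V ℝ) ⊗ₖ U') := by
    simp only [Commute, SemiconjBy, ← Matrix.mul_kronecker_mul, mul_one, one_mul]
  rw [productWalk, smul_pow, hcomm.add_pow, Matrix.smul_apply, Matrix.sum_apply, smul_eq_mul,
    Finset.mul_sum]
  refine Finset.sum_congr rfl fun r _ => ?_
  rw [kronecker_pow, kronecker_pow, one_pow, one_pow, ← Matrix.mul_kronecker_mul, mul_one, one_mul,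
    ← nsmul_eq_mul', Matrix.smul_apply, nsmul_eq_mul, Matrix.kronecker_apply, binomialWeight,
    mul_assoc]

lemma sum_abs_productWalk_pow_sub_le {ρ : V → ℝ} {ρ' : V' → ℝ} (hρ : ρ ∈ stdSimplex ℝ V)
    (hU' : U' ∈ Matrix.rowStochastic ℝ V') (s : ℕ) (x : V × V') :
    ∑ y : V × V', |(productWalk U U' ^ s) x y - ρ y.1 * ρ' y.2| ≤
      ∑ r ∈ Finset.range (s + 1), binomialWeight s r *
        (∑ j, |(U ^ r) x.1 j - ρ j| + ∑ j, |(U' ^ (s - r)) x.2 j - ρ' j|) := by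
  have hrow (q : ℕ) : (U' ^ q) x.2 ∈ stdSimplex ℝ V' :=
    ⟨fun _ => Matrix.nonneg_of_mem_rowStochastic (pow_mem hU' q),
      Matrix.sum_row_of_mem_rowStochastic (pow_mem hU' q) x.2⟩
  have hsub (y : V × V') : (productWalk U U' ^ s) x y - ρ y.1 * ρ' y.2 =
      ∑ r ∈ Finset.range (s + 1), binomialWeight s r *
        ((U ^ r) x.1 y.1 * (U' ^ (s - r)) x.2 y.2 - ρ y.1 * ρ' y.2) := by
    simp only [mul_sub (binomialWeight s _), Finset.sum_sub_distrib, ← Finset.sum_mul,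
      sum_binomialWeight, one_mul, productWalk_pow_apply]
  calc ∑ y : V × V', |(productWalk U U' ^ s) x y - ρ y.1 * ρ' y.2|
      ≤ ∑ y : V × V', ∑ r ∈ Finset.range (s + 1), binomialWeight s r *
          |(U ^ r) x.1 y.1 * (U' ^ (s - r)) x.2 y.2 - ρ y.1 * ρ' y.2| := by
        refine Finset.sum_le_sum fun y _ => ?_
        rw [hsub]
        refine (Finset.abs_sum_le_sum_abs _ _).trans_eq (Finset.sum_congr rfl fun r _ => ?_)
        rw [abs_mul, abs_of_nonneg (binomialWeight_nonneg s r)]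
    _ = ∑ r ∈ Finset.range (s + 1), binomialWeight s r *
          ∑ y : V × V', |(U ^ r) x.1 y.1 * (U' ^ (s - r)) x.2 y.2 - ρ y.1 * ρ' y.2| := by
        rw [Finset.sum_comm]
        simp only [Finset.mul_sum]
    _ ≤ ∑ r ∈ Finset.range (s + 1), binomialWeight s r *
          (∑ j, |(U ^ r) x.1 j - ρ j| + ∑ j, |(U' ^ (s - r)) x.2 j - ρ' j|) :=
        Finset.sum_le_sum fun r _ => mul_le_mul_of_nonneg_left
          (sum_abs_mul_sub_mul_le hρ (hrow _)) (binomialWeight_nonneg s r)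

lemma MixesWithin.prod {ρ : V → ℝ} {ρ' : V' → ℝ} {S S' : ℝ} (hU : MixesWithin U ρ S)
    (hU' : MixesWithin U' ρ' S') (hρ : ρ ∈ stdSimplex ℝ V)
    (hstoch : U' ∈ Matrix.rowStochastic ℝ V') :
    MixesWithin (productWalk U U') (fun x => ρ x.1 * ρ' x.2) (2 * S + 2 * S') := by
  intro x t
  have hflip (s : ℕ) : ∑ r ∈ Finset.range (s + 1),
      binomialWeight s r * ∑ j, |(U' ^ (s - r)) x.2 j - ρ' j| =
      ∑ r ∈ Finset.range (s + 1), binomialWeight s r * ∑ j, |(U' ^ r) x.2 j - ρ' j| := by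
    rw [← Finset.sum_flip]
    refine Finset.sum_congr rfl fun r hr => ?_
    have hrs : r ≤ s := Nat.lt_succ_iff.1 (Finset.mem_range.1 hr)
    rw [binomialWeight_symm hrs, Nat.sub_sub_self hrs]
  refine (Finset.sum_le_sum fun s _ => sum_abs_productWalk_pow_sub_le hρ hstoch s x).trans ?_
  simp only [mul_add, Finset.sum_add_distrib, hflip]
  exact add_le_add
    (sum_sum_binomialWeight_mul_le (fun _ => Finset.sum_nonneg fun _ _ => abs_nonneg _) (hU x.1) t)
    (sum_sum_binomialWeight_mul_le (fun _ => Finset.sum_nonneg fun _ _ => abs_nonneg _) (hU' x.2) t)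

lemma IsEigenfunction.prod {l l' : ℝ} {f : V → ℂ} {f' : V' → ℂ}
    (hf : IsEigenfunction U l f) (hf' : IsEigenfunction U' l' f') :
    IsEigenfunction (productWalk U U') ((l + l') / 2) fun x => f x.1 * f' x.2 := by
  intro x
  have hentry (y : V × V') : productWalk U U' x y • (f y.1 * f' y.2) =
      (1 / 2 : ℝ) • ((U x.1 y.1 • f y.1) * (if x.2 = y.2 then f' y.2 else 0) +
        (if x.1 = y.1 then f y.1 else 0) * (U' x.2 y.2 • f' y.2)) := by
    simp only [productWalk_apply, Complex.real_smul]
    split_ifs <;> push_cast <;> ring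
  simp only [hentry, ← Finset.smul_sum, Finset.sum_add_distrib, Fintype.sum_prod_type,
    ← Finset.mul_sum, ← Finset.sum_mul, Finset.sum_ite_eq, Finset.mem_univ, if_true, hf x.1,
    hf' x.2]
  simp only [Complex.real_smul]
  push_cast
  ring

open Classical in
lemma commMatrix_apply_of_isRegularOfDegree {G : SimpleGraph V} [G.LocallyFinite] {d : ℕ}
    (hG : G.IsRegularOfDegree d) (ω : ℝ) (i j : V) :
    commMatrix G ω i j = if i = j then ω else if G.Adj i j then (1 - ω) / d else 0 := by
  rw [← hG.degree_eq i, commMatrix, Matrix.of_apply]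
  congr!

lemma commMatrix_boxProd {G : SimpleGraph V} {H : SimpleGraph V'} [G.LocallyFinite]
    [H.LocallyFinite] {d : ℕ} (hG : G.IsRegularOfDegree d) (hH : H.IsRegularOfDegree d)
    (ω : ℝ) :
    commMatrix (G.boxProd H) ω = productWalk (commMatrix G ω) (commMatrix H ω) := by
  classical
  have hGH : (G.boxProd H).IsRegularOfDegree (d + d) := fun x => by
    rw [SimpleGraph.degree_boxProd, hG.degree_eq, hH.degree_eq]
  have hhalf : (1 - ω) / (d + d : ℕ) = 1 / 2 * ((1 - ω) / d) := by
    push_cast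
    ring
  ext ⟨x, x'⟩ ⟨y, y'⟩
  simp only [productWalk_apply, commMatrix_apply_of_isRegularOfDegree hGH,
    commMatrix_apply_of_isRegularOfDegree hG, commMatrix_apply_of_isRegularOfDegree hH, hhalf,
    Prod.mk.injEq, SimpleGraph.boxProd_adj]
  by_cases h : x = y <;> by_cases h' : x' = y' <;> simp [h, h', ← two_mul]

end Product

/-! ### The torus -/

lemma commMatrix_mem_rowStochastic {V : Type} [Fintype V] [DecidableEq V] {G : SimpleGraph V}
    [DecidableRel G.Adj] {ω : ℝ} (h0 : 0 ≤ ω) (h1 : ω ≤ 1) (hG : ∀ i, 0 < G.degree i) :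
    commMatrix G ω ∈ Matrix.rowStochastic ℝ V := by
  refine Matrix.mem_rowStochastic_iff_sum.2 ⟨fun i j => ?_, fun i => sum_commMatrix (hG i)⟩
  have : 0 ≤ 1 - ω := sub_nonneg.2 h1
  simp only [commMatrix, Matrix.of_apply]
  split_ifs <;> positivity

section Torus

variable {k : ℕ} {ω : ℝ}

lemma commMatrix_torusGrid (ω : ℝ) :
    commMatrix (torusGrid (k + 3)) ω =
      productWalk (commMatrix (SimpleGraph.cycleGraph (k + 3)) ω)
        (commMatrix (SimpleGraph.cycleGraph (k + 3)) ω) :=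
  commMatrix_boxProd (d := 2) (fun _ => SimpleGraph.cycleGraph_degree_three_le)
    (fun _ => SimpleGraph.cycleGraph_degree_three_le) ω

lemma mixesWithin_torus (h0 : 0 < ω) (h1 : ω < 1) :
    MixesWithin (commMatrix (torusGrid (k + 3)) ω)
      (fun _ => 1 / ((k + 3 : ℕ) : ℝ) * (1 / ((k + 3 : ℕ) : ℝ)))
      (2 * cycleMixingSum (k + 3) ω + 2 * cycleMixingSum (k + 3) ω) := by
  have huniform : (fun _ => 1 / ((k + 3 : ℕ) : ℝ)) ∈ stdSimplex ℝ (Fin (k + 3)) := by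
    refine ⟨fun _ => by positivity, ?_⟩
    rw [Finset.sum_const, Finset.card_univ, Fintype.card_fin, nsmul_eq_mul,
      mul_one_div_cancel (by positivity)]
  have hstoch := commMatrix_mem_rowStochastic (G := SimpleGraph.cycleGraph (k + 3)) h0.le h1.le
    fun _ => by rw [SimpleGraph.cycleGraph_degree_three_le]; exact two_pos
  have hmix := (mixesWithin_cycle h0 h1).prod (mixesWithin_cycle h0 h1) huniform hstoch
  rwa [commMatrix_torusGrid]

lemma spectralGap_torus_le_of_cycleEigenvalue (a b : Fin (k + 3))
    (hab : (cycleEigenvalue ω a + cycleEigenvalue ω b) / 2 ≠ 1) :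
    spectralGap (commMatrix (torusGrid (k + 3)) ω) ≤
      1 - |(cycleEigenvalue ω a + cycleEigenvalue ω b) / 2| := by
  rw [commMatrix_torusGrid]
  refine ((isEigenfunction_cycleChar ω a 0).prod (isEigenfunction_cycleChar ω b 0)).spectralGap_le
    (Function.ne_iff.2 ⟨0, norm_ne_zero_iff.1 ?_⟩) hab
  rw [norm_mul, norm_cycleChar, norm_cycleChar, one_mul]
  exact one_ne_zero

lemma spectralGap_torus_le (h0 : 0 < ω) (h1 : ω < 1) :
    spectralGap (commMatrix (torusGrid (k + 3)) ω) ≤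
      2 * (1 - ω) * Real.sin (Real.pi / (k + 3 : ℕ)) ^ 2 := by
  have hzero : cycleEigenvalue ω (0 : Fin (k + 3)) = 1 := by simp [cycleEigenvalue]
  have hone := one_sub_cycleEigenvalue ω (1 : Fin (k + 3))
  rw [Fin.val_one, Nat.cast_one, mul_one_div] at hone
  have hlt := (le_abs_self _).trans_lt
    (abs_cycleEigenvalue_lt_one h0 h1 (one_ne_zero : (1 : Fin (k + 3)) ≠ 0))
  have hgap := spectralGap_torus_le_of_cycleEigenvalue (ω := ω) (1 : Fin (k + 3)) 0
    (by rw [hzero]; linarith)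
  rw [hzero] at hgap
  linarith [le_abs_self ((cycleEigenvalue ω (1 : Fin (k + 3)) + 1) / 2)]

lemma spectralGap_torus_le_of_even (h1 : ω < 1) (he : Even (k + 3)) :
    spectralGap (commMatrix (torusGrid (k + 3)) ω) ≤ 2 * ω := by
  obtain ⟨a, ha⟩ := exists_cycleEigenvalue_eq ω he
  have hgap := spectralGap_torus_le_of_cycleEigenvalue (ω := ω) a a (by rw [ha]; linarith)
  rw [ha, add_self_div_two] at hgap
  linarith [neg_abs_le (2 * ω - 1)]

end Torus

/-! ### The decentralization cost on the three networks -/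

section Networks

variable {B ι δ ω : ℝ}

lemma one_sub_abs_two_mul_sub_one_pos (h0 : 0 < ω) (h1 : ω < 1) : 0 < 1 - |2 * ω - 1| :=
  sub_pos.2 (abs_lt.2 ⟨by linarith, by linarith⟩)

lemma min_cycle_pos (n : ℕ) (h0 : 0 < ω) (h1 : ω < 1) :
    0 < min (1 - |2 * ω - 1|) (2 * (1 - ω) * Real.sin (Real.pi / (n + 3 : ℕ)) ^ 2) := by
  have hsin : 0 < Real.sin (Real.pi / (n + 3 : ℕ)) :=
    Real.sin_pos_of_pos_of_lt_pi (by positivity)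
      (div_lt_self Real.pi_pos (by exact_mod_cast (by omega : 1 < n + 3)))
  have := sub_pos.2 h1
  exact lt_min (one_sub_abs_two_mul_sub_one_pos h0 h1) (by positivity)

lemma cycleMixingSum_mul_min_le (n : ℕ) (h0 : 0 < ω) (h1 : ω < 1) :
    cycleMixingSum (n + 3) ω *
      min (1 - |2 * ω - 1|) (2 * (1 - ω) * Real.sin (Real.pi / (n + 3 : ℕ)) ^ 2) ≤ 50 :=
  cycleMixingSum_mul_le h0 h1 (min_le_right _ _) fun _ =>
    (min_le_left _ _).trans (by linarith [neg_abs_le (2 * ω - 1)])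

lemma costBound_star {n : ℕ} (c : Fin n) (hB : 0 < B) (hι : 0 < ι) (hδ : 0 < δ) (hn : 3 ≤ n)
    (hδn : 1 / δ ≤ n) (h0 : 0 < ω) (h1 : ω < 1) :
    CostBound.{u, v} (commMatrix (SimpleGraph.starGraph c) ω) B ι δ fun m T =>
      costConst B ι 200 * (Real.log (n * m * T) / min (1 - ω) (1 - |2 * ω - 1|)) := by
  have : Nontrivial (Fin n) := Fin.nontrivial_iff_two_le.2 (by omega)
  have hω : 0 < 1 - ω := sub_pos.2 h1
  have habs := one_sub_abs_two_mul_sub_one_pos h0 h1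
  have hmin : 0 < min (1 - ω) (1 - |2 * ω - 1|) := lt_min hω habs
  have hK : (3 / (1 - ω) + 1 / (1 - |2 * ω - 1|)) * min (1 - ω) (1 - |2 * ω - 1|) ≤ 200 := by
    calc (3 / (1 - ω) + 1 / (1 - |2 * ω - 1|)) * min (1 - ω) (1 - |2 * ω - 1|)
        ≤ 3 / (1 - ω) * (1 - ω) + 1 / (1 - |2 * ω - 1|) * (1 - |2 * ω - 1|) := by
          rw [add_mul]
          gcongr
          exacts [min_le_left _ _, min_le_right _ _]
      _ ≤ 200 := by
          rw [div_mul_cancel₀ _ hω.ne', div_mul_cancel₀ _ habs.ne']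
          norm_num
  have hcard : Fintype.card (Fin n) = n := Fintype.card_fin n
  have hcost := costBound_of_mixesWithin.{u, v} hB hι hδ (mixesWithin_star (c := c) h0 h1)
    ((mul_le_mul_of_nonneg_left (spectralGap_star_le (by rwa [hcard]) h0 h1)
      (by positivity)).trans hK) hmin hK (by rwa [hcard]) (by rwa [hcard])
  simpa only [hcard] using hcost

lemma costBound_cycle {n : ℕ} (hB : 0 < B) (hι : 0 < ι) (hδ : 0 < δ) (hn : 3 ≤ n)
    (hδn : 1 / δ ≤ n) (h0 : 0 < ω) (h1 : ω < 1) :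
    CostBound.{u, v} (commMatrix (SimpleGraph.cycleGraph n) ω) B ι δ fun m T =>
      costConst B ι 200 * (Real.log (n * m * T) /
        min (1 - |2 * ω - 1|) (2 * (1 - ω) * Real.sin (Real.pi / n) ^ 2)) := by
  obtain ⟨q, rfl⟩ := Nat.exists_eq_add_of_le' hn
  have hcard : Fintype.card (Fin (q + 3)) = q + 3 := Fintype.card_fin _
  have hcost := costBound_of_mixesWithin.{u, v} (K := 200) hB hι hδ (mixesWithin_cycle h0 h1)
    ((cycleMixingSum_mul_le h0 h1 (spectralGap_cycle_le h0 h1)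
      (spectralGap_cycle_le_of_even h1)).trans (by norm_num)) (min_cycle_pos q h0 h1)
    ((cycleMixingSum_mul_min_le q h0 h1).trans (by norm_num)) (by rwa [hcard]) (by rwa [hcard])
  simpa only [hcard] using hcost

lemma costBound_torus {k : ℕ} (hB : 0 < B) (hι : 0 < ι) (hδ : 0 < δ) (hk : 3 ≤ k)
    (hδk : 1 / δ ≤ (k * k : ℕ)) (h0 : 0 < ω) (h1 : ω < 1) :
    CostBound.{u, v} (commMatrix (torusGrid k) ω) B ι δ fun m T =>
      costConst B ι 200 * (Real.log ((k * k : ℕ) * m * T) /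
        min (1 - |2 * ω - 1|) (2 * (1 - ω) * Real.sin (Real.pi / k) ^ 2)) := by
  obtain ⟨q, rfl⟩ := Nat.exists_eq_add_of_le' hk
  have hcard : Fintype.card (Fin (q + 3) × Fin (q + 3)) = (q + 3) * (q + 3) := by
    rw [Fintype.card_prod, Fintype.card_fin]
  have hgap := cycleMixingSum_mul_le (n := q) h0 h1 (spectralGap_torus_le h0 h1)
    (spectralGap_torus_le_of_even h1)
  have hmin := cycleMixingSum_mul_min_le q h0 h1
  have hcost := costBound_of_mixesWithin.{u, v} (K := 200) hB hι hδ (mixesWithin_torus h0 h1)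
    (by linarith) (min_cycle_pos q h0 h1) (by linarith) (by rw [hcard]; nlinarith)
    (by rwa [hcard])
  simpa only [hcard] using hcost

end Networks

end DistributedDetection

theorem corollary1 (B ι : ℝ) (hB : 0 < B) (hι : 0 < ι) :
    ∃ C : ℝ, 0 < C ∧ ∀ δ : ℝ, 0 < δ → δ < 1 → ∃ N : ℕ, ∀ n : ℕ, N ≤ n →
      ∀ ω : ℝ, 0 < ω → ω < 1 →
        -- star network with `n` agents and centre `c`
        (∀ c : Fin n, DistributedDetection.CostBound.{u, v}
          (DistributedDetection.commMatrix (SimpleGraph.starGraph c) ω) B ι δ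
          (fun m T => C * (Real.log (n * m * T) / min (1 - ω) (1 - |2 * ω - 1|)))) ∧
        -- cycle network with `n` agents
        DistributedDetection.CostBound.{u, v}
          (DistributedDetection.commMatrix (SimpleGraph.cycleGraph n) ω) B ι δ
          (fun m T => C * (Real.log (n * m * T) /
            min (1 - |2 * ω - 1|) (2 * (1 - ω) * Real.sin (Real.pi / n) ^ 2))) ∧
        -- grid network (with wraparounds) with `n = k * k` agents
        (∀ k : ℕ, n = k * k → DistributedDetection.CostBound.{u, v}
          (DistributedDetection.commMatrix (DistributedDetection.torusGrid k) ω) B ι δ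
          (fun m T => C * (Real.log (n * m * T) /
            min (1 - |2 * ω - 1|)
              (2 * (1 - ω) * Real.sin (Real.pi / Real.sqrt n) ^ 2)))) := by
  refine ⟨DistributedDetection.costConst B ι 200,
    DistributedDetection.costConst_pos hB hι (by norm_num), fun δ hδ _ =>
      ⟨max 9 ⌈1 / δ⌉₊, fun n hn ω h0 h1 => ?_⟩⟩
  have hn9 : 9 ≤ n := (le_max_left _ _).trans hn
  have hδn : 1 / δ ≤ n := Nat.ceil_le.1 ((le_max_right _ _).trans hn)
  refine ⟨fun c => DistributedDetection.costBound_star c hB hι hδ (by omega) hδn h0 h1,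
    DistributedDetection.costBound_cycle hB hι hδ (by omega) hδn h0 h1, fun k hk => ?_⟩
  subst hk
  have hsqrt : Real.sqrt ((k * k : ℕ) : ℝ) = k := by
    rw [Nat.cast_mul, Real.sqrt_mul_self (Nat.cast_nonneg k)]
  rw [hsqrt]
  exact DistributedDetection.costBound_torus hB hι hδ (by nlinarith) hδn h0 h1
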